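/- Consider the system of ordinary differential equations \[ \dot z=\cos\theta,\qquad \dot r=\sin\theta,\qquad \dot\theta = z\sin\theta+\Bigl(\frac1r-r\Bigr)\cos\theta \] in the half-plane $r\ge 0$, singular on the axis $r=0$; it describes the geodesics, parametrized by Euclidean arc length, of the metric $r^2e^{-(z^2+r^2)}(dz^2+dr^2)$, which are the profile curves of rotationally symmetric self-shrinkers. For $c\in\mathbf R$ and $T>0$, an orbit on $[0,T]$ emanating from the axis point $(c,0,\pi/2)$ is a triple of continuous functions $(z,r,\theta)$ on $[0,T]$ with $z(0)=c$, $r(0)=0$, $\theta(0)=\pi/2$, such that $r>0$ on $(0,T]$, the first two equations hold on $[0,T]$, and the third holds on $(0,T]$ (with one-sided derivatives at the end points). For $c=\sqrt2$ the orbit is the hemisphere solution \[ z=\sqrt2\cos\frac{t}{\sqrt2},\qquad r=\sqrt2\sin\frac{t}{\sqrt2},\qquad \theta=\frac{\pi}{2}+\frac{t}{\sqrt2}, \] which leaves the first quadrant at $t=\pi/\sqrt2$ and returns to the axis at $t=\sqrt2\,\pi$. Proposition. Let $0<T<\sqrt2\,\pi$ (for instance $T=3\pi/(2\sqrt2)$,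 which is long enough to leave the first quadrant). There is a constant $\delta_c>0$ such that for every $c\in(\sqrt2-\delta_c,\sqrt2+\delta_c)$ there exists an orbit $\tilde\alpha_c=(\tilde z,\tilde r,\theta)(c;\cdot)$ on $[0,T]$ emanating from $(c,0,\pi/2)$; it is unique, in the sense that every orbit on an interval $[0,S]$, $0<S\le T$, emanating from $(c,0,\pi/2)$ agrees with $\tilde\alpha_c$ on $[0,S]$; and the map \[ (\sqrt2-\delta_c,\sqrt2+\delta_c)\times[0,T]\to\mathbf R^3,\qquad (c,t)\mapsto(\tilde z(c;t),\tilde r(c;t),\theta(c;t)) \] is smooth ($C^\infty$ up to the boundary $t=0$ and $t=T$). -/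

import Mathlib

open Set
open scoped ContDiff

/-- `(z, r, θ)` is an orbit, on the time interval `[0, T]`, of the singular system
`z' = cos θ`, `r' = sin θ`, `θ' = z sin θ + (1 / r - r) cos θ`
in the half-plane `r ≥ 0`, which emanates from the point `(c, 0, π / 2)` of the axis `r = 0`.
The first two equations have no singularity and hold on all of `[0, T]` (at time `0` they give the
initial velocity `(0, 1)` of the curve `(z, r)`); the third one is singular where `r = 0`, so it
holds on `(0, T]`, where `r > 0`, and `θ` is continuous at time `0`.  Derivatives at the end points
of the interval are one-sided. -/
structure IsAxisOrbit (c T : ℝ) (z r θ : ℝ → ℝ) : Prop where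
  z_zero : z 0 = c
  r_zero : r 0 = 0
  θ_zero : θ 0 = Real.pi / 2
  continuousOn_θ : ContinuousOn θ (Icc 0 T)
  r_pos : ∀ t ∈ Ioc 0 T, 0 < r t
  deriv_z : ∀ t ∈ Icc 0 T, HasDerivWithinAt z (Real.cos (θ t)) (Icc 0 T) t
  deriv_r : ∀ t ∈ Icc 0 T, HasDerivWithinAt r (Real.sin (θ t)) (Icc 0 T) t
  deriv_θ : ∀ t ∈ Ioc 0 T,
    HasDerivWithinAt θ (z t * Real.sin (θ t) + (1 / r t - r t) * Real.cos (θ t)) (Icc 0 T) t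

/-! The only difficulty is the axis. Write `θ = π/2 + φ`, `φ = tψ`, `r = tρ`. The singular term
`-sin φ / r` behaves like `-φ/t`, and adding `φ/t` compensates it: `(tφ)' = tG` with `G = z cos φ +
ψ(1 - sinc φ / ρ) + t²ρψ sinc φ`, which is regular because `ρ` is close to 1. As `z` and `ρ` are
integrals of functions of `φ`, this is an equation `ψ(t) = ∫₀¹ τ G(tτ) dτ` for `ψ` alone.

Rescaling to `X(s) = ψ(ts)`, `s ∈ [0, 1]`, turns the time `t` into a parameter next to `c`: one
solves `X = axisMap ((c, t), X)` in `C([0, 1], ℝ)`. The map is smooth, since superposition with a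
smooth function is smooth on spaces of continuous functions. At `t = 0` it is the constant `c/2`
(`axisMap_time_zero`), so its derivative in `X` vanishes there and the implicit function theorem
applies. Evaluation at `s = 1` gives orbits smooth in `(c, t)` on an open set around `t = 0`, hence
up to the boundary.

The implicit function theorem gives uniqueness only among profiles near `c₀/2`. That every orbit is
of this kind for short times follows from `φ/t → c/2`, which is l'Hôpital's rule
(`IsAxisOrbit.tendsto_cos_div`).

Away from the axis the theory is classical: the field is replaced near the reference orbit by a
smooth, globally Lipschitz one, whose flow is smooth by the uniform contraction principle. By
compactness nearby flow lines stay where the two fields agree, and they are glued to the local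
family. The hemisphere is the reference orbit. -/

open Filter Topology unitInterval

/-! ### Smoothness of superposition operators -/

section Superposition

/-- Pointwise application of a continuous field of continuous linear maps. -/
noncomputable def ContinuousMap.pointwiseApply (K E F : Type*) [TopologicalSpace K] [CompactSpace K]
    [NormedAddCommGroup E] [NormedSpace ℝ E] [NormedAddCommGroup F] [NormedSpace ℝ F] :
    C(K, E →L[ℝ] F) →L[ℝ] C(K, E) →L[ℝ] C(K, F) :=
  LinearMap.mkContinuous₂
    (LinearMap.mk₂ ℝ (fun (A : C(K, E →L[ℝ] F)) (h : C(K, E)) =>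
        (⟨fun s => A s (h s), by fun_prop⟩ : C(K, F)))
      (fun _ _ _ => by ext; simp) (fun _ _ _ => by ext; simp)
      (fun _ _ _ => by ext; simp) (fun _ _ _ => by ext; simp)) 1 (fun A h => by
    rw [one_mul]
    refine (ContinuousMap.norm_le _ (by positivity)).2 fun s => ?_
    exact (A s).le_of_opNorm_le_of_le (A.norm_coe_le_norm s) (h.norm_coe_le_norm s))

@[simp]
theorem ContinuousMap.pointwiseApply_apply {K E F : Type*} [TopologicalSpace K] [CompactSpace K]
    [NormedAddCommGroup E] [NormedSpace ℝ E]
    [NormedAddCommGroup F] [NormedSpace ℝ F] (A : C(K, E →L[ℝ] F)) (h : C(K, E)) (s : K) :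
    ContinuousMap.pointwiseApply K E F A h s = A s (h s) := rfl

variable {K : Type*} [TopologicalSpace K] [CompactSpace K]

/-- The range of `X` is compact, so `f'` is continuous there with one modulus for all points; the
mean value inequality then makes the remainder small uniformly in `s`. -/
theorem hasFDerivAt_continuousMap_comp {E F : Type*} [NormedAddCommGroup E] [NormedSpace ℝ E]
    [NormedAddCommGroup F] [NormedSpace ℝ F] (f : C(E, F)) (f' : C(E, E →L[ℝ] F))
    (hf : ∀ x, HasFDerivAt f (f' x) x) (X : C(K, E)) :
    HasFDerivAt (fun Y : C(K, E) => f.comp Y)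
      (ContinuousMap.pointwiseApply K E F (f'.comp X)) X := by
  refine .of_isLittleO (Asymptotics.isLittleO_iff.2 fun ε hε => ?_)
  have hu := (isCompact_range X.continuous).uniformContinuousAt_of_continuousAt f'
    (fun a _ => f'.continuous.continuousAt) (Metric.dist_mem_uniformity hε)
  obtain ⟨δ, hδ, hδu⟩ := Metric.mem_uniformity_dist.1 hu
  filter_upwards [Metric.ball_mem_nhds X hδ] with Y hY
  refine (ContinuousMap.norm_le _ (by positivity)).2 fun s => ?_
  have hYs : dist (Y s) (X s) < δ := (ContinuousMap.dist_apply_le_dist s).trans_lt hY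
  have key := (convex_ball (X s) δ).norm_image_sub_le_of_norm_fderiv_le' (𝕜 := ℝ) (f := f)
    (φ := f' (X s)) (C := ε) (fun x _ => (hf x).differentiableAt) (fun x hx => ?_)
    (Metric.mem_ball_self hδ) hYs
  · simp only [ContinuousMap.sub_apply, ContinuousMap.comp_apply,
      ContinuousMap.pointwiseApply_apply]
    refine key.trans (mul_le_mul_of_nonneg_left ?_ hε.le)
    simpa using (Y - X).norm_coe_le_norm s
  · rw [(hf x).fderiv, ← dist_eq_norm, dist_comm]
    exact (hδu (a := X s) (b := x) (by rw [dist_comm]; exact hx) (mem_range_self s)).le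

/-- The derivative is the superposition with `f'` followed by a bounded linear map. The induction
varies the target `F`, because `f'` takes values in `E →L[ℝ] F`. -/
theorem contDiff_nat_continuousMap_comp {E : Type} [NormedAddCommGroup E] [NormedSpace ℝ E]
    (n : ℕ) : ∀ {F : Type} [NormedAddCommGroup F] [NormedSpace ℝ F] (f : C(E, F)),
      ContDiff ℝ n f → ContDiff ℝ n (fun Y : C(K, E) => f.comp Y) := by
  induction n with
  | zero =>
    intro F _ _ f _
    exact contDiff_zero.2 (ContinuousMap.continuous_postcomp f)
  | succ n ih =>
    intro F _ _ f hf
    push_cast at hf ⊢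
    obtain ⟨f', hf', hff'⟩ := contDiff_succ_iff_hasFDerivAt.1 hf
    refine contDiff_succ_iff_hasFDerivAt.2 ⟨_, ?_,
      fun X => hasFDerivAt_continuousMap_comp f ⟨f', hf'.continuous⟩ hff' X⟩
    exact (ContinuousMap.pointwiseApply K E F).contDiff.comp (ih ⟨f', hf'.continuous⟩ hf')

/-- The superposition operator `Y ↦ f ∘ Y` of a smooth map is smooth. -/
theorem ContDiff.continuousMap_comp {E F : Type} [NormedAddCommGroup E] [NormedSpace ℝ E]
    [NormedAddCommGroup F] [NormedSpace ℝ F] {f : C(E, F)} (hf : ContDiff ℝ ∞ f) :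
    ContDiff ℝ ∞ (fun Y : C(K, E) => f.comp Y) :=
  contDiff_infty.2 fun n => contDiff_nat_continuousMap_comp n f (contDiff_infty.1 hf n)

end Superposition

/-! ### Averaging operators -/

section Average

variable {E : Type*} [NormedAddCommGroup E] [NormedSpace ℝ E]

/-- The averaging operator `X ↦ (s ↦ ∫₀¹ τ ^ k X(s τ) dτ)` on `C([0, 1], E)`. -/
noncomputable def averaging (E : Type*) [NormedAddCommGroup E] [NormedSpace ℝ E] (k : ℕ) :
    C(I, E) →L[ℝ] C(I, E) :=
  LinearMap.mkContinuous
    { toFun := fun X => ⟨fun s => ∫ τ in (0 : ℝ)..1,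
        τ ^ k • X (projIcc 0 1 zero_le_one ((s : ℝ) * τ)),
          intervalIntegral.continuous_parametric_intervalIntegral_of_continuous' (by
            unfold Function.uncurry
            have := continuous_projIcc (a := (0 : ℝ)) (b := 1) (h := zero_le_one)
            fun_prop) 0 1⟩
      map_add' := fun X Y => by
        have := continuous_projIcc (a := (0 : ℝ)) (b := 1) (h := zero_le_one)
        ext s
        simp only [ContinuousMap.add_apply, smul_add, ContinuousMap.coe_mk]
        exact intervalIntegral.integral_add
          (Continuous.intervalIntegrable (by fun_prop) _ _)
          (Continuous.intervalIntegrable (by fun_prop) _ _)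
      map_smul' := fun a X => by
        ext s
        simp [smul_comm _ a] } 1 (fun X => by
    rw [one_mul]
    refine (ContinuousMap.norm_le _ (norm_nonneg _)).2 fun s => ?_
    have := intervalIntegral.norm_integral_le_of_norm_le_const (a := 0) (b := 1) (C := ‖X‖)
      (f := fun τ : ℝ => τ ^ k • X (projIcc 0 1 zero_le_one ((s : ℝ) * τ))) (fun τ hτ => ?_)
    · simpa using this
    · rw [uIoc_of_le zero_le_one] at hτ
      rw [norm_smul, norm_pow, Real.norm_of_nonneg hτ.1.le]
      exact (mul_le_of_le_one_left (norm_nonneg _) (pow_le_one₀ hτ.1.le hτ.2)).trans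
        (X.norm_coe_le_norm _))

theorem averaging_apply (k : ℕ) (X : C(I, E)) (s : I) :
    averaging E k X s =
      ∫ τ in (0 : ℝ)..1, τ ^ k • X (projIcc 0 1 zero_le_one ((s : ℝ) * τ)) := rfl

theorem averaging_eq_of_forall {k : ℕ} {X : C(I, E)} {u : ℝ → E} {t : ℝ}
    (h : ∀ s : I, X s = u (t * s)) (s : I) :
    averaging E k X s = ∫ τ in (0 : ℝ)..1, τ ^ k • u (t * s * τ) := by
  rw [averaging_apply]
  refine intervalIntegral.integral_congr fun τ hτ => ?_
  rw [uIcc_of_le zero_le_one] at hτ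
  have hs : (s : ℝ) * τ ∈ Icc (0 : ℝ) 1 :=
    ⟨mul_nonneg s.2.1 hτ.1, mul_le_one₀ s.2.2 hτ.1 hτ.2⟩
  simp only [projIcc_of_mem zero_le_one hs, h, mul_assoc]

end Average

/-! ### Fixed points by the implicit function theorem -/

section FixedPoint

variable {P E : Type*} [NormedAddCommGroup P] [NormedSpace ℝ P] [CompleteSpace P]
  [NormedAddCommGroup E] [NormedSpace ℝ E] [CompleteSpace E] {H : P × E → E}

/-- The implicit function theorem for `x - H (p, x)`, whose derivative in `x` is invertible by the
Neumann series. -/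
theorem exists_contDiffAt_fixedPoint (hH : ContDiff ℝ ∞ H) {p₀ : P} {x₀ : E}
    (h₀ : H (p₀, x₀) = x₀)
    (hd : ‖(fderiv ℝ H (p₀, x₀)).comp (ContinuousLinearMap.inr ℝ P E)‖ < 1) :
    ∃ g : P → E, ContDiffAt ℝ ∞ g p₀ ∧ g p₀ = x₀ ∧
      ∀ᶠ y in 𝓝 (p₀, x₀), H y = y.2 ↔ g y.1 = y.2 := by
  have hF : ContDiffAt ℝ ∞ (fun y : P × E => y.2 - H y) (p₀, x₀) :=
    contDiffAt_snd.sub hH.contDiffAt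
  have hn : (∞ : WithTop ℕ∞) ≠ 0 := by simp
  have hinv : (fderiv ℝ (fun y : P × E => y.2 - H y) (p₀, x₀) ∘L
      ContinuousLinearMap.inr ℝ P E).IsInvertible := by
    have hfd : fderiv ℝ (fun y : P × E => y.2 - H y) (p₀, x₀) =
        ContinuousLinearMap.snd ℝ P E - fderiv ℝ H (p₀, x₀) :=
      (hasFDerivAt_snd.sub (hH.differentiable hn _).hasFDerivAt).fderiv
    rw [hfd]
    obtain ⟨u, hu⟩ := isUnit_one_sub_of_norm_lt_one hd
    refine ⟨ContinuousLinearEquiv.unitsEquiv ℝ E u, ?_⟩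
    ext x
    simp [hu]
  refine ⟨hF.implicitFunction hn hinv, hF.contDiffAt_implicitFunction hn hinv,
    hF.implicitFunction_apply_self hn hinv, ?_⟩
  filter_upwards [hF.eventually_apply_eq_iff_implicitFunction hn hinv] with y hy
  rw [← hy, h₀, sub_self, sub_eq_zero, eq_comm]

/-- Smooth dependence on parameters of the fixed point of a map whose derivative at the fixed
point is a contraction, on a whole neighbourhood of the parameter. -/
theorem exists_contDiffOn_fixedPoint (hH : ContDiff ℝ ∞ H) {p₀ : P} {x₀ : E}
    (h₀ : H (p₀, x₀) = x₀)
    (hd : ‖(fderiv ℝ H (p₀, x₀)).comp (ContinuousLinearMap.inr ℝ P E)‖ < 1) :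
    ∃ g : P → E, ∃ U ∈ 𝓝 p₀, ∃ W ∈ 𝓝 x₀, IsOpen U ∧ MapsTo g U W ∧ g p₀ = x₀ ∧
      (∀ p ∈ U, ∀ x ∈ W, H (p, x) = x ↔ g p = x) ∧ ContDiffOn ℝ ∞ g U := by
  obtain ⟨g, hg, hg₀, hgH⟩ := exists_contDiffAt_fixedPoint hH h₀ hd
  have hcont : Continuous fun y : P × E =>
      ‖(fderiv ℝ H y).comp (ContinuousLinearMap.inr ℝ P E)‖ :=
    ((hH.continuous_fderiv (by simp)).clm_comp continuous_const).norm
  have hev := hgH.and (hcont.continuousAt.eventually_lt continuousAt_const hd)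
  obtain ⟨U₁, W, hU₁, hp₀, hW, hx₀, hUW⟩ := mem_nhds_prod_iff'.1 hev
  have hN : {p | p ∈ U₁ ∧ g p ∈ W} ∈ 𝓝 p₀ :=
    Filter.inter_mem (hU₁.mem_nhds hp₀) (hg.continuousAt.eventually (hW.mem_nhds (by rwa [hg₀])))
  refine ⟨g, interior {p | p ∈ U₁ ∧ g p ∈ W}, interior_mem_nhds.2 hN, W, hW.mem_nhds hx₀,
    isOpen_interior, fun p hp => (interior_subset hp).2, hg₀,
    fun p hp x hx => (hUW (mk_mem_prod (interior_subset hp).1 hx)).1, fun p hp => ?_⟩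
  have hpU := interior_subset hp
  have hpp := hUW (mk_mem_prod hpU.1 hpU.2)
  -- Smoothness of order `∞` at `p₀` gives neighbourhoods that depend on the order. The theorem is
  -- therefore applied again at each `p`, and local uniqueness identifies the new branch with `g`.
  obtain ⟨g', hg', hgp, hgH'⟩ :=
    exists_contDiffAt_fixedPoint hH (hpp.1.2 rfl) hpp.2
  refine (hg'.congr_of_eventuallyEq ?_).contDiffWithinAt
  have htend : Tendsto (fun q => (q, g' q)) (𝓝 p) (𝓝 (p, g p)) := by
    have := continuousAt_id.prodMk hg'.continuousAt
    simpa [ContinuousAt, hgp] using this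
  filter_upwards [htend.eventually hgH',
    htend.eventually ((hU₁.prod hW).mem_nhds (mk_mem_prod hpU.1 hpU.2))] with q hq hq'
  exact (hUW hq').1.1 (hq.2 rfl)

end FixedPoint

/-! ### Fixed points of uniform contractions -/

section UniformContraction

variable {P E : Type*} [NormedAddCommGroup P] [NormedSpace ℝ P] [CompleteSpace P]
  [NormedAddCommGroup E] [NormedSpace ℝ E] [CompleteSpace E] {H : P × E → E}

/-- The uniform contraction principle: the fixed point depends smoothly on the parameter. -/
theorem exists_contDiffOn_fixedPoint_of_contractingWith (hH : ContDiff ℝ ∞ H) {Ω : Set P}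
    (hΩ : IsOpen Ω) {k : NNReal} (hk : ∀ p ∈ Ω, ContractingWith k fun x => H (p, x)) :
    ∃ g : P → E, ContDiffOn ℝ ∞ g Ω ∧ ∀ p ∈ Ω, ∀ x, H (p, x) = x ↔ g p = x := by
  classical
  let g : P → E := fun p => if hp : p ∈ Ω then (hk p hp).fixedPoint else 0
  have hg : ∀ p ∈ Ω, ∀ x, H (p, x) = x ↔ g p = x := by
    intro p hp x
    simp only [g, hp, dif_pos]
    refine ⟨fun h => ((hk p hp).fixedPoint_unique h).symm, fun h => ?_⟩
    rw [← h]
    exact (hk p hp).fixedPoint_isFixedPt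
  refine ⟨g, fun p hp => ?_, hg⟩
  have hfix := (hg p hp (g p)).2 rfl
  have hd : ‖(fderiv ℝ H (p, g p)).comp (ContinuousLinearMap.inr ℝ P E)‖ < 1 := by
    have h1 : HasFDerivAt (fun x => H (p, x))
        ((fderiv ℝ H (p, g p)).comp (ContinuousLinearMap.inr ℝ P E)) (g p) :=
      (hH.differentiable (by simp) (p, g p)).hasFDerivAt.comp (g p)
        (hasFDerivAt_prodMk_right p (g p))
    rw [← h1.fderiv]
    exact (norm_fderiv_le_of_lipschitz ℝ (hk p hp).2).trans_lt (hk p hp).1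
  obtain ⟨g', hg', hgp, hgH⟩ := exists_contDiffAt_fixedPoint hH hfix hd
  refine (hg'.congr_of_eventuallyEq ?_).contDiffWithinAt
  have htend : Tendsto (fun q => (q, g' q)) (𝓝 p) (𝓝 (p, g p)) := by
    have := continuousAt_id.prodMk hg'.continuousAt
    simpa [ContinuousAt, hgp] using this
  filter_upwards [htend.eventually hgH, hΩ.mem_nhds hp] with q hq hqΩ
  exact (hg q hqΩ _).1 (hq.2 rfl)

end UniformContraction

/-! ### The smooth flow of a Lipschitz vector field -/

section Flow

/-- Averages commute with dilations of `[0, 1]`; hence restricting a rescaled solution from time `t`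
to time `t * μ` gives again a rescaled solution. -/
theorem averaging_dilate {E : Type*} [NormedAddCommGroup E] [NormedSpace ℝ E] {k : ℕ}
    (X Z : C(I, E)) (μ : I) (h : ∀ s, Z s = X (μ * s)) (s : I) :
    averaging E k Z s = averaging E k X (μ * s) := by
  rw [averaging_eq_of_forall (t := 1) (X := X) (u := fun y => X (projIcc 0 1 zero_le_one y))
    (by simp), averaging_eq_of_forall (t := μ)
    (u := fun y => X (projIcc 0 1 zero_le_one y))]
  · simp
  · intro s
    have : projIcc (0 : ℝ) 1 zero_le_one (μ * s) = μ * s :=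
      projIcc_of_mem zero_le_one (μ * s).2
    rw [h, this]

/-- Multiplication by a fixed scalar function. -/
noncomputable def ContinuousMap.mulCLM (E : Type*) [NormedAddCommGroup E] [NormedSpace ℝ E]
    (w : C(I, ℝ)) : C(I, E) →L[ℝ] C(I, E) :=
  ContinuousMap.pointwiseApply I E E ⟨fun s => w s • ContinuousLinearMap.id ℝ E, by fun_prop⟩

/-- The inclusion of the constant functions. -/
noncomputable def ContinuousMap.constantCLM (E : Type*) [NormedAddCommGroup E] [NormedSpace ℝ E] :
    E →L[ℝ] C(I, E) :=
  LinearMap.mkContinuous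
    { toFun := fun x => ContinuousMap.const I x
      map_add' := fun _ _ => rfl
      map_smul' := fun _ _ => rfl } 1 (fun x => by
    rw [one_mul]
    exact (ContinuousMap.norm_le _ (norm_nonneg x)).2 fun _ => le_rfl)

variable {E : Type} [NormedAddCommGroup E] [NormedSpace ℝ E]

@[simp]
theorem ContinuousMap.mulCLM_apply (w : C(I, ℝ)) (X : C(I, E)) (s : I) :
    ContinuousMap.mulCLM E w X s = w s • X s := by
  simp [ContinuousMap.mulCLM]

@[simp]
theorem ContinuousMap.constantCLM_apply (x : E) (s : I) :
    ContinuousMap.constantCLM E x s = x := rfl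

/-- The identity of `[0, 1]` as a real function. -/
def ContinuousMap.coordinate : C(I, ℝ) := ⟨fun s => s, continuous_subtype_val⟩

@[simp]
theorem ContinuousMap.coordinate_apply (s : I) : ContinuousMap.coordinate s = s := rfl

/-- The exponential weight `s ↦ exp (a s)`. -/
noncomputable def expWeight (a : ℝ) : C(I, ℝ) := ⟨fun s => Real.exp (a * s), by fun_prop⟩

@[simp]
theorem expWeight_apply (a : ℝ) (s : I) : expWeight a s = Real.exp (a * s) := rfl

/-- The integral equation of the rescaled solution `s ↦ x(t s)` of `x' = f(x)`. -/
noncomputable def picardMap (f : C(E, E)) (p : (E × ℝ) × C(I, E)) : C(I, E) :=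
  ContinuousMap.constantCLM E p.1.1 +
    p.1.2 • ContinuousMap.mulCLM E ContinuousMap.coordinate (averaging E 0 (f.comp p.2))

theorem picardMap_apply (f : C(E, E)) (x : E) (t : ℝ) (X : C(I, E)) (s : I) :
    picardMap f ((x, t), X) s = x + t • (s : ℝ) • averaging E 0 (f.comp X) s := by
  simp [picardMap]

theorem contDiff_picardMap {f : C(E, E)} (hf : ContDiff ℝ ∞ f) : ContDiff ℝ ∞ (picardMap f) := by
  have h := hf.continuousMap_comp (K := I)
  unfold picardMap
  refine ((ContinuousLinearMap.contDiff _).comp (contDiff_fst.comp contDiff_fst)).add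
    ((contDiff_snd.comp contDiff_fst).smul ?_)
  exact (ContinuousLinearMap.contDiff _).comp ((ContinuousLinearMap.contDiff _).comp
    (h.comp contDiff_snd))

/-- `picardMap` conjugated by an exponential weight. -/
noncomputable def weightedPicardMap (f : C(E, E)) (a : ℝ) (p : (E × ℝ) × C(I, E)) : C(I, E) :=
  ContinuousMap.mulCLM E (expWeight (-a))
    (picardMap f (p.1, ContinuousMap.mulCLM E (expWeight a) p.2))

theorem contDiff_weightedPicardMap {f : C(E, E)} (hf : ContDiff ℝ ∞ f) (a : ℝ) :
    ContDiff ℝ ∞ (weightedPicardMap f a) := by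
  unfold weightedPicardMap
  refine (ContinuousLinearMap.contDiff _).comp ((contDiff_picardMap hf).comp ?_)
  exact contDiff_fst.prodMk ((ContinuousLinearMap.contDiff _).comp contDiff_snd)

theorem mulCLM_expWeight_neg (a : ℝ) (X : C(I, E)) :
    ContinuousMap.mulCLM E (expWeight a) (ContinuousMap.mulCLM E (expWeight (-a)) X) = X := by
  ext s
  simp [smul_smul, ← Real.exp_add]

theorem mulCLM_expWeight_injective (a : ℝ) :
    Function.Injective (ContinuousMap.mulCLM E (expWeight a)) := fun X Y h => by
  have := mulCLM_expWeight_neg (-a) X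
  rw [neg_neg, h] at this
  rw [← this]
  simpa using mulCLM_expWeight_neg (-a) Y

theorem mul_integral_exp_le {a s : ℝ} (ha : 0 < a) :
    s * ∫ τ in (0 : ℝ)..1, Real.exp (a * (s * τ)) ≤ Real.exp (a * s) / a := by
  have h := intervalIntegral.mul_integral_comp_mul_left (a := 0) (b := 1) (f := Real.exp) (a * s)
  rw [mul_zero, mul_one, integral_exp, Real.exp_zero] at h
  rw [le_div_iff₀ ha]
  simp only [mul_assoc] at h
  nlinarith

/-- Conjugation by the weight `exp (a s)` costs a factor `1 / a` in the Picard integral, so a large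
`a` gives a contraction on an interval of any length. -/
theorem contractingWith_weightedPicardMap {f : C(E, E)} {K : NNReal} (hK : LipschitzWith K f)
    {a t : ℝ} (ha : 0 < a) (ht : 2 * (K * |t|) ≤ a) (x : E) :
    ContractingWith 2⁻¹ fun Y => weightedPicardMap f a ((x, t), Y) := by
  refine ⟨by norm_num, LipschitzWith.of_dist_le_mul fun Y Z => ?_⟩
  refine (ContinuousMap.dist_le (by positivity)).2 fun s => ?_
  have hpr := continuous_projIcc (a := (0 : ℝ)) (b := 1) (h := zero_le_one)
  have hs := s.2.1
  have key : ‖averaging E 0 (f.comp (ContinuousMap.mulCLM E (expWeight a) Y)) s -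
      averaging E 0 (f.comp (ContinuousMap.mulCLM E (expWeight a) Z)) s‖ ≤
      K * dist Y Z * ∫ τ in (0 : ℝ)..1, Real.exp (a * (s * τ)) := by
    rw [averaging_apply, averaging_apply, ← intervalIntegral.integral_sub
      (Continuous.intervalIntegrable (by fun_prop) _ _)
      (Continuous.intervalIntegrable (by fun_prop) _ _), ← intervalIntegral.integral_const_mul]
    refine intervalIntegral.norm_integral_le_of_norm_le zero_le_one
      (Filter.Eventually.of_forall fun τ hτ => ?_)
      (Continuous.intervalIntegrable (by fun_prop) _ _)
    have hsτ : (s : ℝ) * τ ∈ Icc (0 : ℝ) 1 :=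
      ⟨mul_nonneg hs hτ.1.le, mul_le_one₀ s.2.2 hτ.1.le hτ.2⟩
    rw [projIcc_of_mem zero_le_one hsτ, pow_zero, one_smul, one_smul, ← dist_eq_norm]
    refine (hK.dist_le_mul _ _).trans ?_
    rw [mul_assoc]
    gcongr
    rw [ContinuousMap.mulCLM_apply, ContinuousMap.mulCLM_apply, dist_smul₀, expWeight_apply,
      Real.norm_of_nonneg (Real.exp_nonneg _), mul_comm]
    gcongr
    exact ContinuousMap.dist_apply_le_dist _
  have hint := mul_integral_exp_le (s := s) ha
  simp only [weightedPicardMap, ContinuousMap.mulCLM_apply, picardMap_apply]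
  rw [dist_smul₀, dist_add_left, dist_smul₀, dist_smul₀, dist_eq_norm, expWeight_apply,
    Real.norm_of_nonneg (Real.exp_nonneg _), Real.norm_of_nonneg hs, Real.norm_eq_abs]
  have hD : 0 ≤ dist Y Z := dist_nonneg
  calc _ ≤ Real.exp (-a * s) * (|t| * (s * (K * dist Y Z *
        ∫ τ in (0 : ℝ)..1, Real.exp (a * (s * τ))))) := by gcongr
    _ = Real.exp (-a * s) * (|t| * (K * dist Y Z)) *
        (s * ∫ τ in (0 : ℝ)..1, Real.exp (a * (s * τ))) := by ring
    _ ≤ Real.exp (-a * s) * (|t| * (K * dist Y Z)) * (Real.exp (a * s) / a) := by gcongr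
    _ = (K * |t|) / a * dist Y Z * (Real.exp (-a * s) * Real.exp (a * s)) := by ring
    _ = (K * |t|) / a * dist Y Z := by rw [← Real.exp_add]; simp
    _ ≤ _ := by
      gcongr
      rw [div_le_iff₀ ha]
      push_cast
      linarith

variable [CompleteSpace E]

theorem hasDerivAt_integral_of_continuousOn_Ioo {u : ℝ → E} {L t : ℝ}
    (hu : ContinuousOn u (Ioo (-L) L)) (ht : t ∈ Ioo (-L) L) :
    HasDerivAt (fun τ => ∫ y in (0 : ℝ)..τ, u y) (u t) t := by
  have hL : 0 ∈ Ioo (-L) L := by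
    have := ht.1.trans ht.2
    exact ⟨by linarith, by linarith⟩
  exact intervalIntegral.integral_hasDerivAt_right
    (hu.mono (ordConnected_Ioo.uIcc_subset hL ht)).intervalIntegrable
    (hu.stronglyMeasurableAtFilter isOpen_Ioo t ht) (hu.continuousAt (Ioo_mem_nhds ht.1 ht.2))

theorem exists_contDiffOn_picardMap_fixedPoint {f : C(E, E)} (hf : ContDiff ℝ ∞ f) {K : NNReal}
    (hK : LipschitzWith K f) (L : ℝ) :
    ∃ g : E × ℝ → C(I, E), ContDiffOn ℝ ∞ g (univ ×ˢ Ioo (-L) L) ∧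
      ∀ x, ∀ t ∈ Ioo (-L) L, ∀ X, picardMap f ((x, t), X) = X ↔ g (x, t) = X := by
  rcases le_or_gt L 0 with hL | hL
  · refine ⟨0, contDiff_const.contDiffOn, fun x t ht => ?_⟩
    exact absurd (ht.1.trans ht.2) (by linarith)
  have hKL : 0 ≤ K * L := mul_nonneg K.2 hL.le
  -- The summand 1 keeps `a` positive when `K = 0`.
  set a : ℝ := 2 * (K * L) + 1 with ha
  obtain ⟨g, hg, hgH⟩ := exists_contDiffOn_fixedPoint_of_contractingWith
    (contDiff_weightedPicardMap hf a) (isOpen_univ.prod isOpen_Ioo : IsOpen (univ ×ˢ Ioo (-L) L))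
    (k := 2⁻¹) (fun p hp => contractingWith_weightedPicardMap hK (t := p.2) (by linarith) (by
      have : K * |p.2| ≤ K * L := mul_le_mul_of_nonneg_left (abs_lt.2 hp.2).le K.2
      linarith) p.1)
  refine ⟨fun p => ContinuousMap.mulCLM E (expWeight a) (g p),
    (ContinuousLinearMap.contDiff _).comp_contDiffOn hg, fun x t ht X => ?_⟩
  have h := hgH (x, t) ⟨mem_univ _, ht⟩ (ContinuousMap.mulCLM E (expWeight (-a)) X)
  rw [weightedPicardMap, mulCLM_expWeight_neg, (mulCLM_expWeight_injective (-a)).eq_iff] at h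
  rw [h, ← (mulCLM_expWeight_injective (E := E) a).eq_iff, mulCLM_expWeight_neg]

/-- A smooth, globally Lipschitz vector field has a smooth flow on every bounded time interval. -/
theorem exists_contDiffOn_flow {f : E → E} (hf : ContDiff ℝ ∞ f) {K : NNReal}
    (hK : LipschitzWith K f) {L : ℝ} (hL : 0 < L) :
    ∃ Φ : E × ℝ → E, ContDiffOn ℝ ∞ Φ (univ ×ˢ Ioo (-L) L) ∧ ∀ x, Φ (x, 0) = x ∧
      ∀ t ∈ Ioo (-L) L, HasDerivAt (fun τ => Φ (x, τ)) (f (Φ (x, t))) t := by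
  lift f to C(E, E) using hf.continuous
  obtain ⟨g, hg, hgf⟩ := exists_contDiffOn_picardMap_fixedPoint hf hK L
  have hΦ : ContDiffOn ℝ ∞ (fun p => g p 1) (univ ×ˢ Ioo (-L) L) :=
    (ContinuousMap.evalCLM (M := E) ℝ (1 : I)).contDiff.comp_contDiffOn hg
  -- By uniqueness of the fixed point, the solution up to time `t * μ` is the restriction of the one
  -- up to time `t`; so the end values at `s = 1` determine everything.
  have hscale : ∀ x, ∀ t ∈ Ioo (-L) L, ∀ s : I, g (x, t) s = g (x, t * s) 1 := by
    intro x t ht μ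
    have hμ : t * μ ∈ Ioo (-L) L := by
      rw [mem_Ioo, ← abs_lt, abs_mul, abs_of_nonneg μ.2.1] at *
      exact (mul_le_of_le_one_right (abs_nonneg t) μ.2.2).trans_lt ht
    have hfix := (hgf x t ht _).2 rfl
    let Z : C(I, E) := ⟨fun s => g (x, t) (μ * s), by fun_prop⟩
    have hZ : picardMap f ((x, t * μ), Z) = Z := by
      ext s
      have h1 := DFunLike.congr_fun hfix (μ * s)
      rw [picardMap_apply] at h1
      rw [picardMap_apply]
      rw [averaging_dilate (f.comp (g (x, t))) (f.comp Z) μ (fun _ => rfl)]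
      refine Eq.trans ?_ h1
      simp [smul_smul, mul_assoc]
    rw [(hgf x _ hμ Z).1 hZ]
    simp [Z]
  refine ⟨fun p => g p 1, hΦ, fun x => ⟨?_, fun t ht => ?_⟩⟩
  · have h0 := DFunLike.congr_fun ((hgf x 0 ⟨by linarith, hL⟩ _).2 rfl) 1
    rw [picardMap_apply] at h0
    simpa using h0.symm
  · have hint : ∀ τ ∈ Ioo (-L) L, g (x, τ) 1 = x + ∫ u in (0 : ℝ)..τ, f (g (x, u) 1) := by
      intro τ hτ
      have h0 := DFunLike.congr_fun ((hgf x τ hτ _).2 rfl) 1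
      rw [picardMap_apply, averaging_eq_of_forall (t := τ) (u := fun y => f (g (x, y) 1))
        (fun s => by rw [ContinuousMap.comp_apply, hscale x τ hτ])] at h0
      rw [← h0]
      simp [intervalIntegral.smul_integral_comp_mul_left (f := fun y => f (g (x, y) 1))]
    have hcont : ContinuousOn (fun u => f (g (x, u) 1)) (Ioo (-L) L) :=
      f.continuous.comp_continuousOn (hΦ.continuousOn.comp
        (by fun_prop : Continuous fun u : ℝ => (x, u)).continuousOn
        fun u hu => ⟨mem_univ _, hu⟩)
    refine ((hasDerivAt_integral_of_continuousOn_Ioo hcont ht).const_add x).congr_of_eventuallyEq ?_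
    filter_upwards [Ioo_mem_nhds ht.1 ht.2] with τ hτ using hint τ hτ

end Flow

/-! ### A smooth cut-off of the inverse -/

section Cutoff

/-- A smooth function on the line which agrees with the inverse on `[m, ∞)`. -/
noncomputable def cutoffInv (m x : ℝ) : ℝ := Real.smoothTransition (2 * x / m - 1) * x⁻¹

theorem contDiff_cutoffInv {m : ℝ} (hm : 0 < m) : ContDiff ℝ ∞ (cutoffInv m) := by
  rw [contDiff_iff_contDiffAt]
  intro x
  rcases eq_or_ne x 0 with rfl | hx
  · refine (contDiffAt_const (c := (0 : ℝ))).congr_of_eventuallyEq ?_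
    filter_upwards [Iio_mem_nhds (half_pos hm)] with y hy
    rw [cutoffInv, Real.smoothTransition.zero_of_nonpos, zero_mul]
    rw [sub_nonpos, div_le_one hm]
    linarith [mem_Iio.1 hy]
  · refine ContDiffAt.mul ?_ (contDiffAt_inv ℝ hx)
    exact Real.smoothTransition.contDiff.contDiffAt.comp x (by fun_prop)

theorem cutoffInv_of_le {m x : ℝ} (hm : 0 < m) (hx : m ≤ x) : cutoffInv m x = x⁻¹ := by
  rw [cutoffInv, Real.smoothTransition.one_of_one_le, one_mul]
  rw [le_sub_iff_add_le, le_div_iff₀ hm]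
  linarith

end Cutoff

/-! ### Smoothness of `sin x / x` -/

section Sinc

theorem contDiff_sinc : ContDiff ℝ ∞ Real.sinc := by
  rw [contDiff_iff_contDiffAt]
  intro x
  rcases eq_or_ne x 0 with rfl | hx
  · obtain ⟨p, hp⟩ := Real.analyticAt_sin (x := 0)
    rw [Real.sinc_eq_dslope]
    exact hp.has_fpower_series_dslope_fslope.analyticAt.contDiffAt
  · refine (Real.contDiff_sin.contDiffAt.div contDiffAt_id hx).congr_of_eventuallyEq ?_
    filter_upwards [isOpen_ne.mem_nhds hx] with y hy using Real.sinc_of_ne_zero hy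

theorem mul_sinc (x : ℝ) : x * Real.sinc x = Real.sin x := by
  rcases eq_or_ne x 0 with rfl | hx
  · simp
  · rw [Real.sinc_of_ne_zero hx, mul_div_cancel₀ _ hx]

end Sinc

/-! ### The desingularized integral equation at the axis -/

section AxisEquation

/-- The sine as a bundled continuous map. -/
noncomputable def sinMap : C(ℝ, ℝ) := ⟨Real.sin, Real.continuous_sin⟩

/-- The cosine as a bundled continuous map. -/
noncomputable def cosMap : C(ℝ, ℝ) := ⟨Real.cos, Real.continuous_cos⟩

/-- The function `sin x / x` as a bundled continuous map. -/
noncomputable def sincMap : C(ℝ, ℝ) := ⟨Real.sinc, Real.continuous_sinc⟩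

/-- The cut-off inverse as a bundled continuous map. -/
noncomputable def invMap : C(ℝ, ℝ) :=
  ⟨cutoffInv 2⁻¹, (contDiff_cutoffInv (by norm_num)).continuous⟩

/-- The angle `θ - π / 2` at time `t s`, for parameters `((c, t), ψ)`, if it is `t s ψ(s)`. -/
noncomputable def axisAngle (q : (ℝ × ℝ) × C(I, ℝ)) : C(I, ℝ) :=
  q.1.2 • (ContinuousMap.coordinate * q.2)

/-- The height `z` at time `t s`. -/
noncomputable def axisHeight (q : (ℝ × ℝ) × C(I, ℝ)) : C(I, ℝ) :=
  ContinuousMap.constantCLM ℝ q.1.1 -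
    q.1.2 • (ContinuousMap.coordinate * averaging ℝ 0 (sinMap.comp (axisAngle q)))

/-- The mean radial speed `r / (t s)` at time `t s`. -/
noncomputable def axisSpeed (q : (ℝ × ℝ) × C(I, ℝ)) : C(I, ℝ) :=
  averaging ℝ 0 (cosMap.comp (axisAngle q))

/-- The right hand side of the equation `(t θ)' = t G`, in the rescaled unknowns. -/
noncomputable def axisRate (q : (ℝ × ℝ) × C(I, ℝ)) : C(I, ℝ) :=
  axisHeight q * cosMap.comp (axisAngle q) +
    q.2 * (1 - sincMap.comp (axisAngle q) * invMap.comp (axisSpeed q)) +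
    q.1.2 ^ 2 • (ContinuousMap.coordinate ^ 2 * axisSpeed q * q.2 * sincMap.comp (axisAngle q))

/-- The integral equation `ψ = axisMap ((c, t), ψ)` of the orbits emanating from the axis. -/
noncomputable def axisMap (q : (ℝ × ℝ) × C(I, ℝ)) : C(I, ℝ) :=
  averaging ℝ 1 (axisRate q)

theorem contDiff_axisAngle : ContDiff ℝ ∞ axisAngle :=
  (contDiff_snd.comp contDiff_fst).smul (contDiff_const.mul contDiff_snd)

theorem contDiff_sin_axisAngle : ContDiff ℝ ∞ fun q => sinMap.comp (axisAngle q) :=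
  (ContDiff.continuousMap_comp (f := sinMap) Real.contDiff_sin).comp contDiff_axisAngle

theorem contDiff_cos_axisAngle : ContDiff ℝ ∞ fun q => cosMap.comp (axisAngle q) :=
  (ContDiff.continuousMap_comp (f := cosMap) Real.contDiff_cos).comp contDiff_axisAngle

theorem contDiff_axisHeight : ContDiff ℝ ∞ axisHeight :=
  ((ContinuousLinearMap.contDiff _).comp (contDiff_fst.comp contDiff_fst)).sub
    ((contDiff_snd.comp contDiff_fst).smul
      (contDiff_const.mul ((ContinuousLinearMap.contDiff _).comp contDiff_sin_axisAngle)))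

theorem contDiff_axisSpeed : ContDiff ℝ ∞ axisSpeed :=
  (ContinuousLinearMap.contDiff _).comp contDiff_cos_axisAngle

theorem contDiff_axisRate : ContDiff ℝ ∞ axisRate := by
  have hsinc : ContDiff ℝ ∞ fun q => sincMap.comp (axisAngle q) :=
    (ContDiff.continuousMap_comp (f := sincMap) contDiff_sinc).comp contDiff_axisAngle
  have hinv : ContDiff ℝ ∞ fun q => invMap.comp (axisSpeed q) :=
    (ContDiff.continuousMap_comp (f := invMap) (contDiff_cutoffInv (by norm_num))).comp
      contDiff_axisSpeed
  exact ((contDiff_axisHeight.mul contDiff_cos_axisAngle).add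
    (contDiff_snd.mul (contDiff_const.sub (hsinc.mul hinv)))).add
      (((contDiff_snd.comp contDiff_fst).pow 2).smul
        (((contDiff_const.mul contDiff_axisSpeed).mul contDiff_snd).mul hsinc))

theorem contDiff_axisMap : ContDiff ℝ ∞ axisMap :=
  (ContinuousLinearMap.contDiff _).comp contDiff_axisRate

theorem axisAngle_apply (c t : ℝ) (X : C(I, ℝ)) (s : I) :
    axisAngle ((c, t), X) s = t * (s * X s) := by
  simp [axisAngle]

theorem axisHeight_apply (c t : ℝ) (X : C(I, ℝ)) (s : I) :
    axisHeight ((c, t), X) s =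
      c - t * (s * averaging ℝ 0 (sinMap.comp (axisAngle ((c, t), X))) s) := by
  simp [axisHeight]

theorem axisRate_apply (c t : ℝ) (X : C(I, ℝ)) (s : I) :
    axisRate ((c, t), X) s =
      axisHeight ((c, t), X) s * Real.cos (axisAngle ((c, t), X) s) +
      X s * (1 - Real.sinc (axisAngle ((c, t), X) s) *
        cutoffInv 2⁻¹ (axisSpeed ((c, t), X) s)) +
      t ^ 2 * (s ^ 2 * axisSpeed ((c, t), X) s * X s * Real.sinc (axisAngle ((c, t), X) s)) := by
  simp [axisRate, cosMap, sincMap, invMap]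

theorem averaging_zero_right {k : ℕ} (X : C(I, ℝ)) :
    averaging ℝ k X 0 = X 0 / (k + 1) := by
  rw [averaging_apply]
  simp [projIcc_left, integral_pow]
  ring

theorem axisMap_apply_zero (c t : ℝ) (X : C(I, ℝ)) : axisMap ((c, t), X) 0 = c / 2 := by
  have h1 : axisSpeed ((c, t), X) 0 = 1 := by
    rw [axisSpeed, averaging_zero_right]
    simp [axisAngle_apply, cosMap]
  rw [axisMap, averaging_zero_right, axisRate_apply, h1, axisHeight_apply, axisAngle_apply,
    cutoffInv_of_le (by norm_num) (by norm_num)]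
  norm_num

theorem axisAngle_dilate (c t : ℝ) (X Z : C(I, ℝ)) (μ : I) (h : ∀ s, Z s = X (μ * s)) (s : I) :
    axisAngle ((c, t * μ), Z) s = axisAngle ((c, t), X) (μ * s) := by
  simp [axisAngle_apply, h, mul_assoc]

theorem axisSpeed_dilate (c t : ℝ) (X Z : C(I, ℝ)) (μ : I) (h : ∀ s, Z s = X (μ * s)) (s : I) :
    axisSpeed ((c, t * μ), Z) s = axisSpeed ((c, t), X) (μ * s) :=
  averaging_dilate _ _ μ
    (fun s => by simp only [ContinuousMap.comp_apply, axisAngle_dilate c t X Z μ h]) s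

theorem axisHeight_dilate (c t : ℝ) (X Z : C(I, ℝ)) (μ : I) (h : ∀ s, Z s = X (μ * s)) (s : I) :
    axisHeight ((c, t * μ), Z) s = axisHeight ((c, t), X) (μ * s) := by
  rw [axisHeight_apply, axisHeight_apply, averaging_dilate
    (sinMap.comp (axisAngle ((c, t), X))) (sinMap.comp (axisAngle ((c, t * μ), Z))) μ
    (fun s => by simp only [ContinuousMap.comp_apply, axisAngle_dilate c t X Z μ h]) s]
  simp [mul_assoc]

theorem axisRate_dilate (c t : ℝ) (X Z : C(I, ℝ)) (μ : I) (h : ∀ s, Z s = X (μ * s)) (s : I) :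
    axisRate ((c, t * μ), Z) s = axisRate ((c, t), X) (μ * s) := by
  rw [axisRate_apply, axisRate_apply, axisHeight_dilate c t X Z μ h, axisAngle_dilate c t X Z μ h,
    axisSpeed_dilate c t X Z μ h, h]
  push_cast
  ring

theorem axisMap_dilate (c t : ℝ) (X Z : C(I, ℝ)) (μ : I) (h : ∀ s, Z s = X (μ * s)) (s : I) :
    axisMap ((c, t * μ), Z) s = axisMap ((c, t), X) (μ * s) :=
  averaging_dilate _ _ μ (axisRate_dilate c t X Z μ h) s

theorem averaging_of_forall_eq {k : ℕ} {X : C(I, ℝ)} {a : ℝ} (h : ∀ s, X s = a) (s : I) :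
    averaging ℝ k X s = a / (k + 1) := by
  rw [averaging_apply]
  simp [h, integral_pow]
  ring

/-- At `t = 0` the angle is 0 and the mean speed 1, so the factor of `X` in the rate is `1 - 1 * 1 =
0`. What remains is `c`, and `∫₀¹ τ dτ = 1/2`. -/
theorem axisMap_time_zero (c : ℝ) (X : C(I, ℝ)) :
    axisMap ((c, 0), X) = ContinuousMap.constantCLM ℝ (c / 2) := by
  ext s
  have hspeed : ∀ s, axisSpeed ((c, 0), X) s = 1 := fun s => by
    rw [axisSpeed, averaging_of_forall_eq (a := 1) (by simp [axisAngle_apply, cosMap])]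
    simp
  rw [axisMap, averaging_of_forall_eq (a := c), ContinuousMap.constantCLM_apply]
  · norm_num
  · intro s
    rw [axisRate_apply, hspeed, axisHeight_apply, axisAngle_apply,
      cutoffInv_of_le (by norm_num) (by norm_num)]
    norm_num

/-- From `cos x ≥ 1 - x² / 2`. Under this bound the cut-off of the inverse at `2⁻¹` is inactive. -/
theorem half_le_axisSpeed {c t : ℝ} {X : C(I, ℝ)} (h : ∀ s, |axisAngle ((c, t), X) s| ≤ 1) (s : I) :
    2⁻¹ ≤ axisSpeed ((c, t), X) s := by
  have hpr := continuous_projIcc (a := (0 : ℝ)) (b := 1) (h := zero_le_one)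
  have hc : ∫ _ in (0 : ℝ)..1, (2⁻¹ : ℝ) = 2⁻¹ := by simp
  rw [axisSpeed, averaging_apply, ← hc]
  refine intervalIntegral.integral_mono zero_le_one (by simp)
    (Continuous.intervalIntegrable (by fun_prop) _ _) fun τ => ?_
  simp only [pow_zero, one_smul, ContinuousMap.comp_apply, cosMap, ContinuousMap.coe_mk]
  have h1 := Real.one_sub_sq_div_two_le_cos
    (x := axisAngle ((c, t), X) (projIcc 0 1 zero_le_one (s * τ)))
  have h2 := (sq_le_one_iff_abs_le_one _).2 (h (projIcc 0 1 zero_le_one (s * τ)))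
  linarith

/-- Undoes the rescaling: the rate is `φ / t` plus the right-hand side of the equation for `φ`, that
is `(tφ)' / t`, at time `t * s`. -/
theorem axisRate_eq {c t : ℝ} {X : C(I, ℝ)} {s : I} (hts : t * s ≠ 0)
    (h : 2⁻¹ ≤ axisSpeed ((c, t), X) s) :
    axisRate ((c, t), X) s = axisAngle ((c, t), X) s / (t * s) +
      (axisHeight ((c, t), X) s * Real.cos (axisAngle ((c, t), X) s) -
        (1 / (t * s * axisSpeed ((c, t), X) s) - t * s * axisSpeed ((c, t), X) s) *
          Real.sin (axisAngle ((c, t), X) s)) := by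
  have hpos : axisSpeed ((c, t), X) s ≠ 0 := by linarith
  have hX : X s = axisAngle ((c, t), X) s / (t * s) := by
    rw [axisAngle_apply, ← mul_assoc, mul_div_cancel_left₀ _ hts]
  rw [axisRate_apply, cutoffInv_of_le (by norm_num) h, hX, ← mul_sinc]
  have ht : t ≠ 0 := left_ne_zero_of_mul hts
  have hs : (s : ℝ) ≠ 0 := right_ne_zero_of_mul hts
  field_simp
  ring

theorem pow_mul_averaging {k : ℕ} {X : C(I, ℝ)} {u : ℝ → ℝ} {t : ℝ}
    (h : ∀ s : I, X s = u (t * s)) (s : I) :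
    (t * s) ^ (k + 1) * averaging ℝ k X s = ∫ y in (0 : ℝ)..(t * s), y ^ k * u y := by
  have h1 := intervalIntegral.mul_integral_comp_mul_left (a := 0) (b := 1)
    (f := fun y => y ^ k * u y) (t * s)
  rw [mul_zero, mul_one] at h1
  rw [averaging_eq_of_forall h, ← h1, pow_succ', mul_assoc,
    ← intervalIntegral.integral_const_mul]
  simp only [smul_eq_mul, mul_pow, mul_assoc]

theorem axisHeight_eq_integral {c t : ℝ} {X : C(I, ℝ)} {φ : ℝ → ℝ}
    (h : ∀ s : I, axisAngle ((c, t), X) s = φ (t * s)) (s : I) :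
    axisHeight ((c, t), X) s = c - ∫ y in (0 : ℝ)..(t * s), Real.sin (φ y) := by
  have h1 := pow_mul_averaging (k := 0) (X := sinMap.comp (axisAngle ((c, t), X)))
    (u := fun y => Real.sin (φ y)) (t := t) (by simp [h, sinMap]) s
  simp only [zero_add, pow_one, pow_zero, one_mul] at h1
  rw [axisHeight_apply, ← h1, mul_assoc]

theorem mul_axisSpeed_eq_integral {c t : ℝ} {X : C(I, ℝ)} {φ : ℝ → ℝ}
    (h : ∀ s : I, axisAngle ((c, t), X) s = φ (t * s)) (s : I) :
    t * s * axisSpeed ((c, t), X) s = ∫ y in (0 : ℝ)..(t * s), Real.cos (φ y) := by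
  have h1 := pow_mul_averaging (k := 0) (X := cosMap.comp (axisAngle ((c, t), X)))
    (u := fun y => Real.cos (φ y)) (t := t) (by simp [h, cosMap]) s
  rw [axisSpeed]
  simpa only [zero_add, pow_one, pow_zero, one_mul] using h1

end AxisEquation

/-! ### Orbits near the axis from the integral equation -/

section LocalOrbit

theorem exists_axisMap_fixedPoint (c₀ : ℝ) :
    ∃ δ > 0, ∃ w > 0, ∃ g : ℝ × ℝ → C(I, ℝ),
      ContDiffOn ℝ ∞ g (Ioo (c₀ - δ) (c₀ + δ) ×ˢ Ioo (-δ) δ) ∧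
      ∀ c ∈ Ioo (c₀ - δ) (c₀ + δ), ∀ t ∈ Ioo (-δ) δ,
        axisMap ((c, t), g (c, t)) = g (c, t) ∧
        (∀ s, |axisAngle ((c, t), g (c, t)) s| ≤ 1) ∧
        (∀ s : I, g (c, t) s = g (c, t * s) 1) ∧
        ∀ X, (∀ s, |X s - c₀ / 2| < w) → axisMap ((c, t), X) = X → g (c, t) = X := by
  set x₀ := ContinuousMap.constantCLM ℝ (c₀ / 2) with hx₀
  have hd : (fderiv ℝ axisMap ((c₀, 0), x₀)).comp
      (ContinuousLinearMap.inr ℝ (ℝ × ℝ) C(I, ℝ)) = 0 := by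
    have h1 : HasFDerivAt (fun x => axisMap ((c₀, 0), x))
        ((fderiv ℝ axisMap ((c₀, 0), x₀)).comp (ContinuousLinearMap.inr ℝ (ℝ × ℝ) C(I, ℝ))) x₀ :=
      (contDiff_axisMap.differentiable (by simp) ((c₀, 0), x₀)).hasFDerivAt.comp x₀
        (hasFDerivAt_prodMk_right (c₀, (0 : ℝ)) x₀)
    rw [← h1.fderiv]
    simp_rw [axisMap_time_zero]
    exact fderiv_const_apply _
  obtain ⟨g, U, hU, W, hW, hUo, hgU, hg₀, hgH, hgs⟩ := exists_contDiffOn_fixedPoint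
    contDiff_axisMap (axisMap_time_zero c₀ x₀) (by rw [hd, norm_zero]; exact zero_lt_one)
  obtain ⟨w', hw', hwW⟩ := Metric.mem_nhds_iff.1 hW
  -- The bound 1 gives `|X s| ≤ |c₀ / 2| + 1` in the ball, whence the angle is at most 1 for the
  -- times allowed in `hN`.
  set w := min w' 1
  have hw : 0 < w := lt_min hw' one_pos
  have hball : ∀ X : C(I, ℝ), X ∈ Metric.ball x₀ w ↔ ∀ s, |X s - c₀ / 2| < w := fun X => by
    rw [Metric.mem_ball, ContinuousMap.dist_lt_iff hw]
    simp [hx₀, Real.dist_eq]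
  have hwW' : Metric.ball x₀ w ⊆ W := (Metric.ball_subset_ball (min_le_left _ _)).trans hwW
  have hN : {p : ℝ × ℝ | p ∈ U ∧ g p ∈ Metric.ball x₀ w ∧ |p.2| * (|c₀ / 2| + 1) < 1} ∈
      𝓝 (c₀, (0 : ℝ)) := by
    refine Filter.inter_mem hU (Filter.inter_mem ?_ ?_)
    · exact (hgs.continuousOn.continuousAt hU).preimage_mem_nhds
        (by rw [hg₀]; exact Metric.ball_mem_nhds _ hw)
    · have : Continuous fun p : ℝ × ℝ => |p.2| * (|c₀ / 2| + 1) := by fun_prop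
      exact this.continuousAt.eventually_lt continuousAt_const (by simp)
  obtain ⟨δ, hδ, hδN⟩ := Metric.mem_nhds_iff.1 hN
  rw [← ball_prod_same, Real.ball_eq_Ioo, Real.ball_eq_Ioo, zero_sub, zero_add] at hδN
  have hfix : ∀ c ∈ Ioo (c₀ - δ) (c₀ + δ), ∀ t ∈ Ioo (-δ) δ,
      axisMap ((c, t), g (c, t)) = g (c, t) := fun c hc t ht => by
    have h := hδN (mk_mem_prod hc ht)
    exact (hgH _ h.1 _ (hwW' h.2.1)).2 rfl
  have huniq : ∀ c ∈ Ioo (c₀ - δ) (c₀ + δ), ∀ t ∈ Ioo (-δ) δ, ∀ X : C(I, ℝ),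
      (∀ s, |X s - c₀ / 2| < w) → axisMap ((c, t), X) = X → g (c, t) = X :=
    fun c hc t ht X hX h =>
      (hgH _ (hδN (mk_mem_prod hc ht)).1 X (hwW' ((hball X).2 hX))).1 h
  refine ⟨δ, hδ, w, hw, g, hgs.mono fun p hp => (hδN hp).1, fun c hc t ht =>
    ⟨hfix c hc t ht, fun s => ?_, fun μ => ?_, huniq c hc t ht⟩⟩
  · have h := hδN (mk_mem_prod hc ht)
    have h1 := (hball _).1 h.2.1 s
    have h2 : |g (c, t) s| ≤ |c₀ / 2| + 1 := by
      have := abs_sub_abs_le_abs_sub (g (c, t) s) (c₀ / 2)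
      have := min_le_right w' 1
      linarith
    rw [axisAngle_apply, abs_mul, abs_mul, abs_of_nonneg s.2.1]
    calc |t| * (s * |g (c, t) s|) ≤ |t| * (1 * (|c₀ / 2| + 1)) := by
          gcongr
          exact s.2.2
      _ ≤ 1 := by
          rw [one_mul]
          exact h.2.2.le
  · have hμ : t * μ ∈ Ioo (-δ) δ := by
      rw [mem_Ioo, ← abs_lt, abs_mul, abs_of_nonneg μ.2.1] at *
      exact (mul_le_of_le_one_right (abs_nonneg t) μ.2.2).trans_lt ht
    let Z : C(I, ℝ) := ⟨fun s => g (c, t) (μ * s), by fun_prop⟩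
    have hZ : axisMap ((c, t * μ), Z) = Z := by
      ext s
      rw [axisMap_dilate c t (g (c, t)) Z μ (fun _ => rfl), hfix c hc t ht]
      rfl
    -- The dilated profile `Z` takes only values of `g (c, t)`, so it stays in the ball where fixed
    -- points are unique.
    rw [huniq c hc _ hμ Z (fun s => (hball _).1 (hδN (mk_mem_prod hc ht)).2.1 (μ * s)) hZ]
    simp [Z]

/-- By `hscale` the profiles for different `t` are restrictions of single functions `φ` and `G` of
time. The fixed point equation becomes `t φ(t) = ∫₀ᵗ y G(y) dy`, which is differentiated for `t >
0`. -/
theorem isAxisOrbit_of_axisMap_fixedPoint {c δ : ℝ} {g : ℝ → C(I, ℝ)}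
    (hg : ContinuousOn g (Ioo (-δ) δ))
    (hfix : ∀ t ∈ Ioo (-δ) δ, axisMap ((c, t), g t) = g t)
    (hangle : ∀ t ∈ Ioo (-δ) δ, ∀ s, |axisAngle ((c, t), g t) s| ≤ 1)
    (hscale : ∀ t ∈ Ioo (-δ) δ, ∀ s : I, g t s = g (t * s) 1) {S : ℝ} (hS : S ∈ Ioo 0 δ) :
    IsAxisOrbit c S (fun t => axisHeight ((c, t), g t) 1)
      (fun t => t * axisSpeed ((c, t), g t) 1)
      (fun t => Real.pi / 2 + axisAngle ((c, t), g t) 1) := by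
  have hmem : ∀ t ∈ Ioo (-δ) δ, ∀ s : I, t * s ∈ Ioo (-δ) δ := fun t ht s => by
    rw [mem_Ioo, ← abs_lt, abs_mul, abs_of_nonneg s.2.1] at *
    exact (mul_le_of_le_one_right (abs_nonneg t) s.2.2).trans_lt ht
  have hdil : ∀ t ∈ Ioo (-δ) δ, ∀ s s' : I, g (t * s) s' = g t (s * s') := fun t ht s s' => by
    rw [hscale _ (hmem t ht s), hscale t ht]
    simp [mul_assoc]
  set φ : ℝ → ℝ := fun t => axisAngle ((c, t), g t) 1 with hφ
  set G : ℝ → ℝ := fun t => axisRate ((c, t), g t) 1 with hG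
  have hφs : ∀ t ∈ Ioo (-δ) δ, ∀ s : I, axisAngle ((c, t), g t) s = φ (t * s) := fun t ht s => by
    simpa using (axisAngle_dilate c t (g t) (g (t * s)) s (hdil t ht s) 1).symm
  have hGs : ∀ t ∈ Ioo (-δ) δ, ∀ s : I, axisRate ((c, t), g t) s = G (t * s) := fun t ht s => by
    simpa using (axisRate_dilate c t (g t) (g (t * s)) s (hdil t ht s) 1).symm
  have hpair : ContinuousOn (fun t => ((c, t), g t)) (Ioo (-δ) δ) :=
    (by fun_prop : Continuous fun t : ℝ => (c, t)).continuousOn.prodMk hg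
  have hφc : ContinuousOn φ (Ioo (-δ) δ) :=
    (continuous_eval_const (1 : I)).comp_continuousOn
      (contDiff_axisAngle.continuous.comp_continuousOn hpair)
  have hGc : ContinuousOn G (Ioo (-δ) δ) :=
    (continuous_eval_const (1 : I)).comp_continuousOn
      (contDiff_axisRate.continuous.comp_continuousOn hpair)
  have hz : ∀ t ∈ Ioo (-δ) δ,
      axisHeight ((c, t), g t) 1 = c - ∫ y in (0 : ℝ)..t, Real.sin (φ y) := fun t ht => by
    simpa using axisHeight_eq_integral (hφs t ht) 1
  have hr : ∀ t ∈ Ioo (-δ) δ,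
      t * axisSpeed ((c, t), g t) 1 = ∫ y in (0 : ℝ)..t, Real.cos (φ y) := fun t ht => by
    simpa using mul_axisSpeed_eq_integral (hφs t ht) 1
  have hI : ∀ t ∈ Ioo (-δ) δ, t * φ t = ∫ y in (0 : ℝ)..t, y * G y := fun t ht => by
    have h1 := pow_mul_averaging (hGs t ht) 1 (k := 1)
    have h2 := DFunLike.congr_fun (hfix t ht) 1
    rw [axisMap] at h2
    rw [h2] at h1
    simp only [Icc.coe_one, mul_one, pow_one] at h1
    rw [← h1, hφ]
    simp [axisAngle_apply]
    ring
  have hsub : Icc 0 S ⊆ Ioo (-δ) δ := fun t ht =>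
    ⟨by linarith [hS.1, hS.2, ht.1], ht.2.trans_lt hS.2⟩
  have h0 : (0 : ℝ) ∈ Ioo (-δ) δ := hsub ⟨le_rfl, hS.1.le⟩
  refine ⟨?_, ?_, ?_, ?_, ?_, ?_, ?_, ?_⟩
  · simp [hz 0 h0]
  · simp
  · simp [axisAngle_apply]
  · exact (continuousOn_const.add hφc).mono hsub
  · intro t ht
    have := half_le_axisSpeed (hangle t (hsub (Ioc_subset_Icc_self ht))) 1
    exact mul_pos ht.1 (by linarith)
  · intro t ht
    have hd := (hasDerivAt_integral_of_continuousOn_Ioo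
      (Real.continuous_sin.comp_continuousOn hφc) (hsub ht)).const_sub c
    rw [add_comm, Real.cos_add_pi_div_two]
    refine (hd.congr_of_eventuallyEq ?_).hasDerivWithinAt
    filter_upwards [Ioo_mem_nhds (hsub ht).1 (hsub ht).2] with τ hτ using hz τ hτ
  · intro t ht
    have hd := hasDerivAt_integral_of_continuousOn_Ioo
      (Real.continuous_cos.comp_continuousOn hφc) (hsub ht)
    rw [add_comm, Real.sin_add_pi_div_two]
    refine (hd.congr_of_eventuallyEq ?_).hasDerivWithinAt
    filter_upwards [Ioo_mem_nhds (hsub ht).1 (hsub ht).2] with τ hτ using hr τ hτ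
  · intro t ht
    have htS := hsub (Ioc_subset_Icc_self ht)
    have ht0 : t ≠ 0 := ht.1.ne'
    have hd := (hasDerivAt_integral_of_continuousOn_Ioo (continuousOn_id.mul hGc) htS).div
      (hasDerivAt_id t) ht0
    have hd' : HasDerivAt (fun τ => Real.pi / 2 + φ τ) _ t :=
      HasDerivAt.congr_of_eventuallyEq (hd.const_add (Real.pi / 2)) (by
        filter_upwards [Ioo_mem_nhds htS.1 htS.2, isOpen_ne.mem_nhds ht0] with τ hτ hτ0
        have := hI τ hτ
        simp only [Pi.div_apply, Pi.mul_apply, id]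
        rw [← this, mul_div_cancel_left₀ _ hτ0])
    refine (hd'.congr_deriv ?_).hasDerivWithinAt
    have hrate := axisRate_eq (c := c) (t := t) (X := g t) (s := 1) (by simpa using ht0)
      (half_le_axisSpeed (hangle t htS) 1)
    have hI' := hI t htS
    simp only [Icc.coe_one, mul_one] at hrate
    simp only [Pi.mul_apply, id]
    rw [← hI', add_comm (Real.pi / 2), Real.sin_add_pi_div_two, Real.cos_add_pi_div_two]
    change (t * (axisRate ((c, t), g t) 1) * t - _) / _ = _
    rw [hrate, hφ]
    field_simp
    ring

end LocalOrbit

/-! ### Behaviour of an arbitrary orbit at the axis -/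

namespace IsAxisOrbit

variable {c S : ℝ} {z r θ : ℝ → ℝ}

theorem hasDerivAt_z (h : IsAxisOrbit c S z r θ) {t : ℝ} (ht : t ∈ Ioo 0 S) :
    HasDerivAt z (Real.cos (θ t)) t :=
  (h.deriv_z t (Ioo_subset_Icc_self ht)).hasDerivAt (Icc_mem_nhds ht.1 ht.2)

theorem hasDerivAt_r (h : IsAxisOrbit c S z r θ) {t : ℝ} (ht : t ∈ Ioo 0 S) :
    HasDerivAt r (Real.sin (θ t)) t :=
  (h.deriv_r t (Ioo_subset_Icc_self ht)).hasDerivAt (Icc_mem_nhds ht.1 ht.2)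

theorem hasDerivAt_θ (h : IsAxisOrbit c S z r θ) {t : ℝ} (ht : t ∈ Ioo 0 S) :
    HasDerivAt θ (z t * Real.sin (θ t) + (1 / r t - r t) * Real.cos (θ t)) t :=
  (h.deriv_θ t (Ioo_subset_Ioc_self ht)).hasDerivAt (Icc_mem_nhds ht.1 ht.2)

theorem continuousOn_z (h : IsAxisOrbit c S z r θ) : ContinuousOn z (Icc 0 S) :=
  fun t ht => (h.deriv_z t ht).continuousWithinAt

theorem continuousOn_r (h : IsAxisOrbit c S z r θ) : ContinuousOn r (Icc 0 S) :=
  fun t ht => (h.deriv_r t ht).continuousWithinAt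

theorem tendsto_of_continuousOn {f : ℝ → ℝ} (hS : 0 < S) (hf : ContinuousOn f (Icc 0 S)) :
    Tendsto f (𝓝[>] 0) (𝓝 (f 0)) := by
  rw [← nhdsWithin_Ioc_eq_nhdsGT hS]
  exact (hf 0 ⟨le_rfl, hS.le⟩).mono Ioc_subset_Icc_self

/-- L'Hôpital's rule for `-r cos θ / r²`. The extra factor `r` makes the singular terms `±sin θ cos
θ` cancel in the derivative of the numerator, and the quotient of derivatives is `(z sin θ - r cos
θ) / 2`. -/
theorem tendsto_cos_div (h : IsAxisOrbit c S z r θ) (hS : 0 < S) :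
    Tendsto (fun u => -Real.cos (θ u) / r u) (𝓝[>] 0) (𝓝 (c / 2)) := by
  have hθ := tendsto_of_continuousOn hS h.continuousOn_θ
  have hz := tendsto_of_continuousOn hS h.continuousOn_z
  have hr := tendsto_of_continuousOn hS h.continuousOn_r
  have hsin : Tendsto (fun u => Real.sin (θ u)) (𝓝[>] 0) (𝓝 1) := by
    have := (Real.continuous_sin.tendsto _).comp hθ
    rwa [h.θ_zero, Real.sin_pi_div_two] at this
  have hcos : Tendsto (fun u => Real.cos (θ u)) (𝓝[>] 0) (𝓝 0) := by
    have := (Real.continuous_cos.tendsto _).comp hθ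
    rwa [h.θ_zero, Real.cos_pi_div_two] at this
  rw [h.z_zero] at hz
  rw [h.r_zero] at hr
  have hIoo : Ioo 0 S ∈ 𝓝[>] (0 : ℝ) := Ioo_mem_nhdsGT hS
  have hsinpos : ∀ᶠ u in 𝓝[>] (0 : ℝ), 0 < Real.sin (θ u) := hsin.eventually_const_lt one_pos
  have key : Tendsto (fun u => r u * -Real.cos (θ u) / r u ^ 2) (𝓝[>] 0) (𝓝 (c / 2)) := by
    refine HasDerivAt.lhopital_zero_nhdsGT
      (f' := fun u => r u * Real.sin (θ u) * (z u * Real.sin (θ u) - r u * Real.cos (θ u)))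
      (g' := fun u => 2 * r u * Real.sin (θ u)) ?_ ?_ ?_ ?_ ?_ ?_
    · filter_upwards [hIoo] with u hu
      have hru := (h.r_pos u (Ioo_subset_Ioc_self hu)).ne'
      refine ((h.hasDerivAt_r hu).mul (h.hasDerivAt_θ hu).cos.neg).congr_deriv ?_
      simp only [Pi.neg_apply]
      field_simp
      ring
    · filter_upwards [hIoo] with u hu
      refine ((h.hasDerivAt_r hu).pow 2).congr_deriv ?_
      simp
    · filter_upwards [hIoo, hsinpos] with u hu hs
      have hru := h.r_pos u (Ioo_subset_Ioc_self hu)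
      positivity
    · simpa using hr.mul hcos.neg
    · simpa using hr.pow 2
    · have hlim : Tendsto (fun u => (z u * Real.sin (θ u) - r u * Real.cos (θ u)) / 2) (𝓝[>] 0)
          (𝓝 (c / 2)) := by
        simpa using ((hz.mul hsin).sub (hr.mul hcos)).div_const 2
      refine hlim.congr' ?_
      filter_upwards [hIoo, hsinpos] with u hu hs
      have hru := (h.r_pos u (Ioo_subset_Ioc_self hu)).ne'
      have := hs.ne'
      field_simp
  refine key.congr' ?_
  filter_upwards [hIoo] with u hu
  have hru := (h.r_pos u (Ioo_subset_Ioc_self hu)).ne'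
  field_simp

/-- With `φ = θ - π/2` one has `sin φ = -cos θ`, so `φ / u` is `(-cos θ / r) (r / u) / sinc φ`. -/
theorem tendsto_angle_div (h : IsAxisOrbit c S z r θ) (hS : 0 < S) :
    Tendsto (fun u => (θ u - Real.pi / 2) / u) (𝓝[>] 0) (𝓝 (c / 2)) := by
  have hθ := (tendsto_of_continuousOn hS h.continuousOn_θ).sub_const (Real.pi / 2)
  rw [h.θ_zero, sub_self] at hθ
  have hsinc := (Real.continuous_sinc.tendsto _).comp hθ
  rw [Real.sinc_zero] at hsinc
  have hr : Tendsto (fun u => r u / u) (𝓝[>] 0) (𝓝 1) := by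
    have := (hasDerivWithinAt_iff_tendsto_slope' (by simp)).1
      ((h.deriv_r 0 ⟨le_rfl, hS.le⟩).mono Ioc_subset_Icc_self)
    rw [h.θ_zero, Real.sin_pi_div_two, nhdsWithin_Ioc_eq_nhdsGT hS] at this
    refine this.congr fun u => ?_
    rw [slope_def_field, h.r_zero, sub_zero, sub_zero]
  have := ((h.tendsto_cos_div hS).mul hr).div hsinc one_ne_zero
  rw [mul_one, div_one] at this
  refine this.congr' ?_
  filter_upwards [Ioo_mem_nhdsGT hS, hsinc.eventually_const_lt one_pos] with u hu hs
  have hru := (h.r_pos u (Ioo_subset_Ioc_self hu)).ne'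
  have hs' : Real.sinc (θ u - Real.pi / 2) ≠ 0 := hs.ne'
  have hu0 := hu.1.ne'
  have h1 := mul_sinc (θ u - Real.pi / 2)
  rw [Real.sin_sub_pi_div_two] at h1
  simp only [Function.comp_apply, Pi.div_apply, ← h1]
  generalize θ u - Real.pi / 2 = a at hs' ⊢
  field_simp

/-- Near the axis, the rescaled angle of every orbit solves the integral equation. -/
theorem exists_axisMap_fixedPoint (h : IsAxisOrbit c S z r θ) (hS : 0 < S) {w : ℝ} (hw : 0 < w) :
    ∃ ε ∈ Ioc 0 S, ∀ t ∈ Ioc 0 ε, ∃ X : C(I, ℝ), (∀ s, |X s - c / 2| < w) ∧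
      axisMap ((c, t), X) = X ∧ z t = axisHeight ((c, t), X) 1 ∧
      r t = t * axisSpeed ((c, t), X) 1 ∧ θ t = Real.pi / 2 + axisAngle ((c, t), X) 1 := by
  set φ : ℝ → ℝ := fun u => θ u - Real.pi / 2 with hφ
  set ψ : ℝ → ℝ := Function.update (fun u => φ u / u) 0 (c / 2) with hψ
  have hψ0 : ψ 0 = c / 2 := by simp [hψ]
  have hφ0 : φ 0 = 0 := by simp [hφ, h.θ_zero]
  have hφψ : ∀ u, u * ψ u = φ u := fun u => by
    rcases eq_or_ne u 0 with rfl | hu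
    · simp [hφ0]
    · rw [hψ, Function.update_of_ne hu, mul_div_cancel₀ _ hu]
  have hφc : ContinuousOn φ (Icc 0 S) := h.continuousOn_θ.sub continuousOn_const
  have hψc : ContinuousOn ψ (Icc 0 S) := by
    rw [continuousOn_update_iff]
    have hdiff : Icc 0 S \ {0} = Ioc 0 S := by simp
    rw [hdiff]
    refine ⟨(hφc.mono Ioc_subset_Icc_self).div continuousOn_id fun u hu => hu.1.ne', fun _ => ?_⟩
    rw [nhdsWithin_Ioc_eq_nhdsGT hS]
    exact h.tendsto_angle_div hS
  have hev : ∀ᶠ u in 𝓝[Icc 0 S] 0, |ψ u - c / 2| < w ∧ |φ u| < 1 := by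
    have h0 : (0 : ℝ) ∈ Icc 0 S := ⟨le_rfl, hS.le⟩
    refine Filter.Eventually.and ?_ ?_
    · exact ((hψc 0 h0).sub continuousWithinAt_const).abs.eventually_lt continuousWithinAt_const
        (by simpa [hψ0] using hw)
    · exact (hφc 0 h0).abs.eventually_lt continuousWithinAt_const (by simp [hφ0])
  obtain ⟨ρ, hρ, hρs⟩ := Metric.mem_nhdsWithin_iff.1 hev
  have hbound : ∀ u ∈ Icc 0 (min (ρ / 2) S), |ψ u - c / 2| < w ∧ |φ u| < 1 := fun u hu =>
    hρs ⟨by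
      rw [Metric.mem_ball, Real.dist_0_eq_abs, abs_of_nonneg hu.1]
      linarith [hu.2.trans (min_le_left _ _)], hu.1, hu.2.trans (min_le_right _ _)⟩
  refine ⟨min (ρ / 2) S, ⟨lt_min (half_pos hρ) hS, min_le_right _ _⟩, fun t ht => ?_⟩
  have htS : t ≤ S := ht.2.trans (min_le_right _ _)
  have hmem : ∀ s : I, t * s ∈ Icc 0 t := fun s =>
    ⟨mul_nonneg ht.1.le s.2.1, mul_le_of_le_one_right ht.1.le s.2.2⟩
  have hbs : ∀ s : I, |ψ (t * s) - c / 2| < w ∧ |φ (t * s)| < 1 := fun s =>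
    hbound _ ⟨(hmem s).1, (hmem s).2.trans ht.2⟩
  let X : C(I, ℝ) := ⟨fun s => ψ (t * s), hψc.comp_continuous (by fun_prop)
    fun s => ⟨(hmem s).1, (hmem s).2.trans htS⟩⟩
  have hX : ∀ s, X s = ψ (t * s) := fun _ => rfl
  have hangle : ∀ s : I, axisAngle ((c, t), X) s = φ (t * s) := fun s => by
    rw [axisAngle_apply, hX, ← mul_assoc, hφψ]
  have hspeed := half_le_axisSpeed (c := c) (t := t) (X := X)
    (fun s => by rw [hangle]; exact (hbs s).2.le)
  have hsub : ∀ s : I, Icc 0 (t * (s : ℝ)) ⊆ Icc 0 S := fun s =>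
    Icc_subset_Icc_right ((hmem s).2.trans htS)
  have hint : ∀ (F F' : ℝ → ℝ) (s : I), ContinuousOn F (Icc 0 S) →
      (∀ u ∈ Ioo 0 S, HasDerivAt F (F' u) u) → ContinuousOn F' (Icc 0 t) →
      ∫ y in (0 : ℝ)..(t * s), F' y = F (t * s) - F 0 := fun F F' s hF hF' hc =>
    intervalIntegral.integral_eq_sub_of_hasDerivAt_of_le (hmem s).1 (hF.mono (hsub s))
      (fun u hu => hF' u ⟨hu.1, hu.2.trans_le ((hmem s).2.trans htS)⟩)
      ((hc.mono (Icc_subset_Icc_right (hmem s).2)).intervalIntegrable_of_Icc (hmem s).1)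
  have hφt : ContinuousOn φ (Icc 0 t) := hφc.mono (Icc_subset_Icc_right htS)
  have hsinφ : ∀ u, Real.sin (φ u) = -Real.cos (θ u) := fun u => Real.sin_sub_pi_div_two _
  have hcosφ : ∀ u, Real.cos (φ u) = Real.sin (θ u) := fun u => Real.cos_sub_pi_div_two _
  have hheight : ∀ s : I, axisHeight ((c, t), X) s = z (t * s) := fun s => by
    have := hint (fun u => - z u) (fun u => Real.sin (φ u)) s h.continuousOn_z.neg
      (fun u hu => by rw [hsinφ]; exact (h.hasDerivAt_z hu).neg)
      (Real.continuous_sin.comp_continuousOn hφt)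
    rw [axisHeight_eq_integral hangle, this, h.z_zero]
    ring
  have hradius : ∀ s : I, t * s * axisSpeed ((c, t), X) s = r (t * s) := fun s => by
    have := hint r (fun u => Real.cos (φ u)) s h.continuousOn_r
      (fun u hu => by rw [hcosφ]; exact h.hasDerivAt_r hu)
      (Real.continuous_cos.comp_continuousOn hφt)
    rw [mul_axisSpeed_eq_integral hangle, this, h.r_zero, sub_zero]
  -- The projection to `[0, 1]` only serves to make `G` continuous on the whole line.
  set G : ℝ → ℝ := fun y => axisRate ((c, t), X) (projIcc 0 1 zero_le_one (y / t)) with hG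
  have hGc : Continuous G := by
    have := continuous_projIcc (a := (0 : ℝ)) (b := 1) (h := zero_le_one)
    fun_prop
  have hGs : ∀ s : I, axisRate ((c, t), X) s = G (t * s) := fun s => by
    simp [hG, mul_div_cancel_left₀ _ ht.1.ne']
  have hderiv : ∀ u ∈ Ioo 0 t, HasDerivAt (fun y => y * φ y) (u * G u) u := by
    intro u hu
    have hu0 := hu.1.ne'
    have ht0 := ht.1.ne'
    obtain ⟨s, hs⟩ : ∃ s : I, t * s = u :=
      ⟨⟨u / t, div_nonneg hu.1.le ht.1.le, (div_le_one ht.1).2 hu.2.le⟩, mul_div_cancel₀ _ ht0⟩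
    have hrate := axisRate_eq (by rw [hs]; exact hu0) (hspeed s)
    rw [hradius, hheight, hangle, hGs, hs, hsinφ, hcosφ] at hrate
    have hd := (hasDerivAt_id u).mul
      ((h.hasDerivAt_θ ⟨hu.1, hu.2.trans_le htS⟩).sub_const (Real.pi / 2))
    refine hd.congr_deriv ?_
    rw [hrate]
    simp only [id, hφ]
    field_simp
    ring
  refine ⟨X, fun s => (hbs s).1, ?_, ?_, ?_, ?_⟩
  · ext s
    -- At `s = 0` the factor `(t * s) ^ 2` cannot be cancelled; there both sides are `c / 2`, by the
    -- choice of `ψ 0`.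
    rcases eq_or_ne s 0 with rfl | hs
    · rw [axisMap_apply_zero, hX]
      simp [hψ0]
    · have hts : t * (s : ℝ) ≠ 0 := mul_ne_zero ht.1.ne' fun h => hs (Subtype.ext h)
      have h1 := pow_mul_averaging hGs s (k := 1)
      have h2 : ∫ y in (0 : ℝ)..(t * s), y * G y = t * s * φ (t * s) - 0 * φ 0 :=
        intervalIntegral.integral_eq_sub_of_hasDerivAt_of_le (f := fun y => y * φ y) (hmem s).1
          ((continuousOn_id.mul hφc).mono (hsub s))
          (fun u hu => hderiv u ⟨hu.1, hu.2.trans_le (hmem s).2⟩)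
          (Continuous.intervalIntegrable (by fun_prop) _ _)
      simp only [pow_one] at h1
      rw [h2, zero_mul, sub_zero, ← hφψ, ← mul_assoc, ← sq] at h1
      rw [hX]
      exact mul_left_cancel₀ (pow_ne_zero 2 hts) h1
  · simpa using (hheight 1).symm
  · simpa using (hradius 1).symm
  · rw [hangle]
    simp [hφ]

end IsAxisOrbit

/-! ### A globally Lipschitz replacement of the field -/

section CutoffField

/-- The vector field of the system, at the point `(z, r, θ)`. -/
noncomputable def orbitField (x : ℝ × ℝ × ℝ) : ℝ × ℝ × ℝ :=
  (Real.cos x.2.2, Real.sin x.2.2,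
    x.1 * Real.sin x.2.2 + (1 / x.2.1 - x.2.1) * Real.cos x.2.2)

/-- The cut-off inverse removes the singularity at `r = 0`; a bump function then gives compact
support, hence a global Lipschitz constant. -/
theorem exists_lipschitzWith_eq_orbitField {m : ℝ} (hm : 0 < m) (M : ℝ) :
    ∃ f : ℝ × ℝ × ℝ → ℝ × ℝ × ℝ, ContDiff ℝ ∞ f ∧ (∃ K, LipschitzWith K f) ∧
      ∀ x, ‖x‖ ≤ M → m ≤ x.2.1 → f x = orbitField x := by
  let b : ContDiffBump (0 : ℝ × ℝ × ℝ) := ⟨|M| + 1, |M| + 2, by positivity, by linarith⟩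
  let F : ℝ × ℝ × ℝ → ℝ × ℝ × ℝ := fun x => (Real.cos x.2.2, Real.sin x.2.2,
    x.1 * Real.sin x.2.2 + (cutoffInv m x.2.1 - x.2.1) * Real.cos x.2.2)
  have hF : ContDiff ℝ ∞ F := by
    have h1 : ContDiff ℝ ∞ fun x : ℝ × ℝ × ℝ => cutoffInv m x.2.1 :=
      (contDiff_cutoffInv hm).comp (contDiff_fst.comp contDiff_snd)
    have h2 : ContDiff ℝ ∞ fun x : ℝ × ℝ × ℝ => x.2.2 := contDiff_snd.comp contDiff_snd
    have h3 : ContDiff ℝ ∞ fun x : ℝ × ℝ × ℝ => x.2.1 := contDiff_fst.comp contDiff_snd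
    exact h2.cos.prodMk (h2.sin.prodMk ((contDiff_fst.mul h2.sin).add ((h1.sub h3).mul h2.cos)))
  have hf : ContDiff ℝ ∞ fun x => b x • F x := b.contDiff.smul hF
  refine ⟨fun x => b x • F x, hf,
    ContDiff.lipschitzWith_of_hasCompactSupport b.hasCompactSupport.smul_right hf (by simp),
    fun x hx hmx => ?_⟩
  have hb : b x = 1 := b.one_of_mem_closedBall (by
    rw [mem_closedBall_zero_iff]
    exact hx.trans ((le_abs_self M).trans (by change |M| ≤ |M| + 1; linarith)))
  simp only [hb, one_smul, F, cutoffInv_of_le hm hmx, orbitField, one_div]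

end CutoffField

/-! ### Uniqueness away from the axis -/

namespace IsAxisOrbit

variable {c S : ℝ} {z r θ z' r' θ' : ℝ → ℝ}

theorem mono (h : IsAxisOrbit c S z r θ) {S' : ℝ} (hS : S' ≤ S) : IsAxisOrbit c S' z r θ where
  z_zero := h.z_zero
  r_zero := h.r_zero
  θ_zero := h.θ_zero
  continuousOn_θ := h.continuousOn_θ.mono (Icc_subset_Icc_right hS)
  r_pos t ht := h.r_pos t ⟨ht.1, ht.2.trans hS⟩
  deriv_z t ht := (h.deriv_z t ⟨ht.1, ht.2.trans hS⟩).mono (Icc_subset_Icc_right hS)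
  deriv_r t ht := (h.deriv_r t ⟨ht.1, ht.2.trans hS⟩).mono (Icc_subset_Icc_right hS)
  deriv_θ t ht := (h.deriv_θ t ⟨ht.1, ht.2.trans hS⟩).mono (Icc_subset_Icc_right hS)

theorem continuousOn_triple (h : IsAxisOrbit c S z r θ) :
    ContinuousOn (fun t => (z t, r t, θ t)) (Icc 0 S) :=
  h.continuousOn_z.prodMk (h.continuousOn_r.prodMk h.continuousOn_θ)

theorem hasDerivAt_triple (h : IsAxisOrbit c S z r θ) {t : ℝ} (ht : t ∈ Ioo 0 S) :
    HasDerivAt (fun t => (z t, r t, θ t)) (orbitField (z t, r t, θ t)) t :=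
  (h.hasDerivAt_z ht).prodMk ((h.hasDerivAt_r ht).prodMk (h.hasDerivAt_θ ht))

theorem exists_bounds (h : IsAxisOrbit c S z r θ) {ε : ℝ} (hε : 0 < ε) :
    ∃ m > 0, ∃ M, ∀ t ∈ Icc ε S, ‖(z t, r t, θ t)‖ ≤ M ∧ m ≤ r t := by
  have hsub : Icc ε S ⊆ Icc 0 S := Icc_subset_Icc_left hε.le
  obtain ⟨M, hM⟩ := isCompact_Icc.exists_bound_of_continuousOn (h.continuousOn_triple.mono hsub)
  rcases (Icc ε S).eq_empty_or_nonempty with he | hne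
  · exact ⟨1, one_pos, 0, by simp [he]⟩
  · obtain ⟨t₀, ht₀, hmin⟩ := isCompact_Icc.exists_isMinOn hne (h.continuousOn_r.mono hsub)
    exact ⟨r t₀, h.r_pos t₀ ⟨hε.trans_le ht₀.1, ht₀.2⟩, M, fun t ht => ⟨hM t ht, hmin ht⟩⟩

theorem eqOn_flow {f : ℝ × ℝ × ℝ → ℝ × ℝ × ℝ} {K : NNReal} (hf : LipschitzWith K f)
    (h : IsAxisOrbit c S z r θ) {ε : ℝ} (hε : 0 < ε)
    (hfz : ∀ t ∈ Icc ε S, f (z t, r t, θ t) = orbitField (z t, r t, θ t))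
    {γ : ℝ → ℝ × ℝ × ℝ} (hγc : ContinuousOn γ (Icc ε S))
    (hγ : ∀ t ∈ Ico ε S, HasDerivAt γ (f (γ t)) t) (hγε : γ ε = (z ε, r ε, θ ε)) :
    EqOn γ (fun t => (z t, r t, θ t)) (Icc ε S) :=
  ODE_solution_unique_of_mem_Icc_right (v := fun _ => f) (s := fun _ => univ)
    (fun _ _ => hf.lipschitzOnWith) hγc (fun t ht => (hγ t ht).hasDerivWithinAt)
    (fun _ _ => mem_univ _) (h.continuousOn_triple.mono (Icc_subset_Icc_left hε.le))
    (fun t ht => by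
      rw [hfz t (Ico_subset_Icc_self ht)]
      exact (h.hasDerivAt_triple ⟨hε.trans_le ht.1, ht.2⟩).hasDerivWithinAt)
    (fun _ _ => mem_univ _) hγε

/-- On `[ε, S]` both orbits are bounded with `r` bounded below, so both solve the equation of one
globally Lipschitz field. -/
theorem eqOn_Icc_right (h : IsAxisOrbit c S z r θ) (h' : IsAxisOrbit c S z' r' θ') {ε : ℝ}
    (hε : 0 < ε) (heq : (z' ε, r' ε, θ' ε) = (z ε, r ε, θ ε)) :
    EqOn (fun t => (z' t, r' t, θ' t)) (fun t => (z t, r t, θ t)) (Icc ε S) := by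
  obtain ⟨m, hm, M, hb⟩ := h.exists_bounds hε
  obtain ⟨m', hm', M', hb'⟩ := h'.exists_bounds hε
  obtain ⟨f, -, ⟨K, hK⟩, hf⟩ := exists_lipschitzWith_eq_orbitField (lt_min hm hm') (max M M')
  refine h.eqOn_flow hK hε (fun t ht => hf _ ((hb t ht).1.trans (le_max_left _ _))
    ((min_le_left _ _).trans (hb t ht).2))
    (h'.continuousOn_triple.mono (Icc_subset_Icc_left hε.le)) (fun t ht => ?_) heq
  have ht' := Ico_subset_Icc_self ht
  rw [hf _ ((hb' t ht').1.trans (le_max_right _ _)) ((min_le_right _ _).trans (hb' t ht').2)]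
  exact h'.hasDerivAt_triple ⟨hε.trans_le ht.1, ht.2⟩

end IsAxisOrbit

/-! ### Continuation, gluing and smooth dependence -/

section Global

theorem exists_local_axisOrbit_family (c₀ : ℝ) :
    ∃ δ > 0, ∃ A : ℝ → ℝ → ℝ × ℝ × ℝ,
      ContDiffOn ℝ ∞ (fun p : ℝ × ℝ => A p.1 p.2) (Ioo (c₀ - δ) (c₀ + δ) ×ˢ Ioo (-δ) δ) ∧
      (∀ c ∈ Ioo (c₀ - δ) (c₀ + δ), ∀ S ∈ Ioo 0 δ,
        IsAxisOrbit c S (fun t => (A c t).1) (fun t => (A c t).2.1) (fun t => (A c t).2.2)) ∧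
      ∀ c ∈ Ioo (c₀ - δ) (c₀ + δ), ∀ S > 0, ∀ z r θ z' r' θ' : ℝ → ℝ,
        IsAxisOrbit c S z r θ → IsAxisOrbit c S z' r' θ' →
        EqOn (fun t => (z' t, r' t, θ' t)) (fun t => (z t, r t, θ t)) (Icc 0 S) := by
  obtain ⟨δ, hδ, w, hw, g, hg, hgf⟩ := exists_axisMap_fixedPoint c₀
  have hsub : ∀ c ∈ Ioo (c₀ - min δ w) (c₀ + min δ w), c ∈ Ioo (c₀ - δ) (c₀ + δ) := fun c hc =>
    ⟨by linarith [hc.1, min_le_left δ w], by linarith [hc.2, min_le_left δ w]⟩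
  have hsubt : ∀ t ∈ Ioo (-min δ w) (min δ w), t ∈ Ioo (-δ) δ := fun c hc =>
    ⟨by linarith [hc.1, min_le_left δ w], by linarith [hc.2, min_le_left δ w]⟩
  have hev : ContDiff ℝ ∞ fun X : C(I, ℝ) => X 1 :=
    (ContinuousMap.evalCLM (M := ℝ) ℝ (1 : I)).contDiff
  have hpair := contDiffOn_id.prodMk hg
  refine ⟨min δ w, lt_min hδ hw, fun c t => (axisHeight ((c, t), g (c, t)) 1,
    t * axisSpeed ((c, t), g (c, t)) 1,
    Real.pi / 2 + axisAngle ((c, t), g (c, t)) 1), ?_, fun c hc S hS => ?_, ?_⟩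
  · refine ContDiffOn.mono (s := Ioo (c₀ - δ) (c₀ + δ) ×ˢ Ioo (-δ) δ) ?_
      fun p hp => ⟨hsub _ hp.1, hsubt _ hp.2⟩
    exact ((hev.comp contDiff_axisHeight).comp_contDiffOn hpair).prodMk
      ((contDiff_snd.contDiffOn.mul ((hev.comp contDiff_axisSpeed).comp_contDiffOn hpair)).prodMk
        (contDiffOn_const.add ((hev.comp contDiff_axisAngle).comp_contDiffOn hpair)))
  · have hc' := hsub c hc
    exact isAxisOrbit_of_axisMap_fixedPoint (g := fun t => g (c, t))
      (hg.continuousOn.comp (by fun_prop : Continuous fun t : ℝ => (c, t)).continuousOn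
        fun t ht => ⟨hc', ht⟩)
      (fun t ht => (hgf c hc' t ht).1) (fun t ht => (hgf c hc' t ht).2.1)
      (fun t ht => (hgf c hc' t ht).2.2.1) ⟨hS.1, hS.2.trans_le (min_le_left _ _)⟩
  · intro c hc S hS z r θ z' r' θ' h h'
    have hcw : |c - c₀| < w := by
      rw [abs_lt]
      constructor <;> linarith [hc.1, hc.2, min_le_right δ w]
    obtain ⟨ε, hε, hεX⟩ := h.exists_axisMap_fixedPoint hS (half_pos hw)
    obtain ⟨ε', hε', hεX'⟩ := h'.exists_axisMap_fixedPoint hS (half_pos hw)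
    -- Since `|c / 2 - c₀ / 2| < w / 2`, profiles within `w / 2` of `c / 2` lie in the uniqueness
    -- ball around `c₀ / 2`.
    have hclose : ∀ X : C(I, ℝ), (∀ s, |X s - c / 2| < w / 2) → ∀ s, |X s - c₀ / 2| < w :=
      fun X hX s => by
        have h1 := hX s
        rw [abs_lt] at *
        constructor <;> linarith
    set t₀ := min (min ε ε') (δ / 2)
    have ht₀ : 0 < t₀ := lt_min (lt_min hε.1 hε'.1) (half_pos hδ)
    have heq : ∀ t ∈ Ioc 0 t₀, (z' t, r' t, θ' t) = (z t, r t, θ t) := by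
      intro t ht
      obtain ⟨X, hX, hfix, h1, h2, h3⟩ := hεX t
        ⟨ht.1, ht.2.trans ((min_le_left _ _).trans (min_le_left _ _))⟩
      obtain ⟨X', hX', hfix', h1', h2', h3'⟩ := hεX' t
        ⟨ht.1, ht.2.trans ((min_le_left _ _).trans (min_le_right _ _))⟩
      have htδ : t ∈ Ioo (-δ) δ :=
        ⟨by linarith [ht.1], by linarith [ht.2.trans (min_le_right (min ε ε') (δ / 2))]⟩
      have hu := (hgf c (hsub c hc) t htδ).2.2.2
      have hXX : X' = X := (hu X' (hclose X' hX') hfix').symm.trans (hu X (hclose X hX) hfix)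
      rw [h1, h2, h3, h1', h2', h3', hXX]
    intro t ht
    rcases ht.1.eq_or_lt with rfl | ht0
    · simp only [h.z_zero, h.r_zero, h.θ_zero, h'.z_zero, h'.r_zero, h'.θ_zero]
    · rcases le_total t t₀ with htt | htt
      · exact heq t ⟨ht0, htt⟩
      · exact h.eqOn_Icc_right h' ht₀ (heq t₀ ⟨ht₀, le_rfl⟩) ⟨htt, ht.2⟩

/-- At the junction both one-sided derivatives are `D`; elsewhere the closed piece that misses `t`
imposes no condition. -/
theorem hasDerivWithinAt_Icc_of_eqOn {u a b : ℝ → ℝ} {D ε T t : ℝ} (hε : 0 ≤ ε) (hεT : ε ≤ T)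
    (ha : EqOn u a (Icc 0 ε)) (hb : EqOn u b (Icc ε T))
    (hda : t ∈ Icc 0 ε → HasDerivWithinAt a D (Icc 0 ε) t)
    (hdb : t ∈ Icc ε T → HasDerivWithinAt b D (Icc ε T) t) :
    HasDerivWithinAt u D (Icc 0 T) t := by
  rw [← Icc_union_Icc_eq_Icc hε hεT]
  refine HasDerivWithinAt.union ?_ ?_
  · by_cases ht : t ∈ Icc 0 ε
    · exact (hda ht).congr ha (ha ht)
    · exact HasFDerivWithinAt.of_notMem_closure (by rwa [isClosed_Icc.closure_eq])
  · by_cases ht : t ∈ Icc ε T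
    · exact (hdb ht).congr hb (hb ht)
    · exact HasFDerivWithinAt.of_notMem_closure (by rwa [isClosed_Icc.closure_eq])

theorem isAxisOrbit_glue {c ε T : ℝ} {β γ α : ℝ → ℝ × ℝ × ℝ} (hε : 0 < ε) (hεT : ε ≤ T)
    (h : IsAxisOrbit c ε (fun t => (β t).1) (fun t => (β t).2.1) (fun t => (β t).2.2))
    (hγ : ∀ t ∈ Icc ε T, HasDerivAt γ (orbitField (γ t)) t ∧ 0 < (γ t).2.1)
    (hαβ : EqOn α β (Icc 0 ε)) (hαγ : EqOn α γ (Icc ε T)) :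
    IsAxisOrbit c T (fun t => (α t).1) (fun t => (α t).2.1) (fun t => (α t).2.2) := by
  have h0 : α 0 = β 0 := hαβ ⟨le_rfl, hε.le⟩
  have hmem : ∀ t ∈ Icc 0 T, t ∈ Icc 0 ε ∨ t ∈ Icc ε T := fun t ht =>
    (le_total t ε).imp (fun h => ⟨ht.1, h⟩) (fun h => ⟨h, ht.2⟩)
  have hz : ∀ t ∈ Icc ε T, HasDerivAt (fun t => (γ t).1) (orbitField (γ t)).1 t :=
    fun t ht => (hasFDerivAt_fst (𝕜 := ℝ) (p := γ t)).comp_hasDerivAt t (hγ t ht).1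
  have hrθ : ∀ t ∈ Icc ε T, HasDerivAt (fun t => (γ t).2) (orbitField (γ t)).2 t :=
    fun t ht => (hasFDerivAt_snd (𝕜 := ℝ) (p := γ t)).comp_hasDerivAt t (hγ t ht).1
  have hr : ∀ t ∈ Icc ε T, HasDerivAt (fun t => (γ t).2.1) (orbitField (γ t)).2.1 t :=
    fun t ht => HasFDerivAt.comp_hasDerivAt (f := fun t => (γ t).2) t
      (hasFDerivAt_fst (𝕜 := ℝ) (p := (γ t).2)) (hrθ t ht)
  have hθ : ∀ t ∈ Icc ε T, HasDerivAt (fun t => (γ t).2.2) (orbitField (γ t)).2.2 t :=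
    fun t ht => HasFDerivAt.comp_hasDerivAt (f := fun t => (γ t).2) t
      (hasFDerivAt_snd (𝕜 := ℝ) (p := (γ t).2)) (hrθ t ht)
  have hdθ : ∀ t ∈ Ioc 0 T, HasDerivWithinAt (fun t => (α t).2.2)
      (orbitField (α t)).2.2 (Icc 0 T) t := fun t ht =>
    hasDerivWithinAt_Icc_of_eqOn hε.le hεT (a := fun t => (β t).2.2) (b := fun t => (γ t).2.2)
      (fun s hs => by simp only [hαβ hs]) (fun s hs => by simp only [hαγ hs])
      (fun h' => by rw [hαβ h']; exact h.deriv_θ t ⟨ht.1, h'.2⟩)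
      (fun h' => by rw [hαγ h']; exact (hθ t h').hasDerivWithinAt)
  refine ⟨?_, ?_, ?_, ?_, ?_, fun t _ => ?_, fun t _ => ?_, hdθ⟩
  · simp only [h0, h.z_zero]
  · simp only [h0, h.r_zero]
  · simp only [h0, h.θ_zero]
  · rw [← Icc_union_Icc_eq_Icc hε.le hεT]
    refine ContinuousOn.union_of_isClosed ?_ ?_ isClosed_Icc isClosed_Icc
    · exact h.continuousOn_θ.congr fun s hs => by simp only [hαβ hs]
    · exact ContinuousOn.congr (fun t ht => (hθ t ht).continuousAt.continuousWithinAt)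
        fun s hs => by simp only [hαγ hs]
  · intro t ht
    rcases hmem t (Ioc_subset_Icc_self ht) with h' | h'
    · simp only [hαβ h']
      exact h.r_pos t ⟨ht.1, h'.2⟩
    · simp only [hαγ h']
      exact (hγ t h').2
  · exact hasDerivWithinAt_Icc_of_eqOn hε.le hεT (a := fun t => (β t).1) (b := fun t => (γ t).1)
      (fun s hs => by simp only [hαβ hs]) (fun s hs => by simp only [hαγ hs])
      (fun h' => by rw [hαβ h']; exact h.deriv_z t h')
      (fun h' => by rw [hαγ h']; exact (hz t h').hasDerivWithinAt)
  · exact hasDerivWithinAt_Icc_of_eqOn hε.le hεT (a := fun t => (β t).2.1)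
      (b := fun t => (γ t).2.1)
      (fun s hs => by simp only [hαβ hs]) (fun s hs => by simp only [hαγ hs])
      (fun h' => by rw [hαβ h']; exact h.deriv_r t h')
      (fun h' => by rw [hαγ h']; exact (hr t h').hasDerivWithinAt)

/-- The orbits emanating from the axis near a given orbit on `[0, T]` exist on `[0, T]`, are
unique, and depend smoothly on the starting point and on time. -/
theorem exists_contDiffOn_axisOrbit_family {c₀ T : ℝ} (hT : 0 < T) {z₀ r₀ θ₀ : ℝ → ℝ}
    (h₀ : IsAxisOrbit c₀ T z₀ r₀ θ₀) :
    ∃ δ > 0, ∃ α : ℝ → ℝ → ℝ × ℝ × ℝ,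
      (∀ c ∈ Ioo (c₀ - δ) (c₀ + δ),
        IsAxisOrbit c T (fun t => (α c t).1) (fun t => (α c t).2.1) (fun t => (α c t).2.2) ∧
        ∀ S : ℝ, 0 < S → S ≤ T → ∀ z' r' θ' : ℝ → ℝ, IsAxisOrbit c S z' r' θ' →
          EqOn (fun t => (z' t, r' t, θ' t)) (α c) (Icc 0 S)) ∧
      ContDiffOn ℝ ∞ (fun p : ℝ × ℝ => α p.1 p.2) (Ioo (c₀ - δ) (c₀ + δ) ×ˢ Icc 0 T) := by
  obtain ⟨δ, hδ, A, hA, hAo, huniq⟩ := exists_local_axisOrbit_family c₀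
  have hc₀ : c₀ ∈ Ioo (c₀ - δ) (c₀ + δ) := ⟨by linarith, by linarith⟩
  -- The pieces are joined at `ε`; the local family lives up to `S' > ε`, and this overlap gives
  -- smoothness across the junction.
  obtain ⟨ε, S', hε, hεS, hSδ, hST⟩ : ∃ ε S' : ℝ, 0 < ε ∧ ε < S' ∧ S' < δ ∧ S' < T := by
    have := lt_min hδ hT
    have h1 := min_le_left δ T
    have h2 := min_le_right δ T
    exact ⟨min δ T / 3, min δ T / 2, by linarith, by linarith, by linarith, by linarith⟩
  have hεδ : ε ∈ Ioo (-δ) δ := ⟨by linarith, by linarith⟩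
  have hεT : ε ≤ T := (hεS.trans hST).le
  have hA₀ : (z₀ ε, r₀ ε, θ₀ ε) = A c₀ ε :=
    huniq c₀ hc₀ ε hε _ _ _ _ _ _ (hAo c₀ hc₀ ε ⟨hε, hεδ.2⟩) (h₀.mono hεT) ⟨hε.le, le_rfl⟩
  obtain ⟨m, hm, M, hmM⟩ := h₀.exists_bounds hε
  -- The margins `m / 2` and `M + 1` leave room for a tube around the reference orbit in which `f`
  -- is the true field.
  obtain ⟨f, hf, ⟨K, hK⟩, hfield⟩ := exists_lipschitzWith_eq_orbitField (half_pos hm) (M + 1)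
  obtain ⟨Φ, hΦ, hΦo⟩ := exists_contDiffOn_flow hf hK hT
  have hΦat : ∀ x, ∀ t ∈ Ioo (-T) T, ContDiffAt ℝ ∞ Φ (x, t) := fun x t ht =>
    hΦ.contDiffAt ((isOpen_univ.prod isOpen_Ioo).mem_nhds ⟨mem_univ _, ht⟩)
  have hsh : ∀ t ∈ Icc ε T, t - ε ∈ Ioo (-T) T := fun t ht =>
    ⟨by linarith [ht.1], by linarith [ht.2]⟩
  have hγ : ∀ x, ∀ t ∈ Icc ε T,
      HasDerivAt (fun t => Φ (x, t - ε)) (f (Φ (x, t - ε))) t := fun x t ht =>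
    ((hΦo x).2 _ (hsh t ht)).comp_sub_const t ε
  have href : EqOn (fun t => Φ (A c₀ ε, t - ε)) (fun t => (z₀ t, r₀ t, θ₀ t)) (Icc ε T) :=
    h₀.eqOn_flow hK hε (fun t ht => hfield _ (by linarith [(hmM t ht).1])
        (by linarith [(hmM t ht).2]))
      (fun t ht => (hγ _ t ht).continuousAt.continuousWithinAt)
      (fun t ht => hγ _ t (Ico_subset_Icc_self ht))
      (by simp only [sub_self, (hΦo _).1, hA₀])
  have htube : ∀ᶠ x in 𝓝 (A c₀ ε), ∀ t ∈ Icc ε T,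
      ‖Φ (x, t - ε)‖ < M + 1 ∧ m / 2 < (Φ (x, t - ε)).2.1 := by
    refine isCompact_Icc.eventually_forall_of_forall_eventually fun t ht => ?_
    have hc : ContinuousAt (fun y : (ℝ × ℝ × ℝ) × ℝ => Φ (y.1, y.2 - ε)) (A c₀ ε, t) :=
      ContinuousAt.comp (f := fun y : (ℝ × ℝ × ℝ) × ℝ => (y.1, y.2 - ε))
        (hΦat _ _ (hsh t ht)).continuousAt (by fun_prop)
    have hval := href ht
    simp only at hval
    refine Filter.Eventually.and ?_ ?_
    · exact hc.norm.eventually_lt continuousAt_const (by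
        simp only [hval]
        linarith [(hmM t ht).1])
    · exact continuousAt_const.eventually_lt hc.snd.fst (by
        simp only [hval]
        linarith [(hmM t ht).2])
  have hAat : ∀ c ∈ Ioo (c₀ - δ) (c₀ + δ), ∀ t ∈ Ioo (-δ) δ,
      ContDiffAt ℝ ∞ (fun p : ℝ × ℝ => A p.1 p.2) (c, t) := fun c hc t ht =>
    hA.contDiffAt ((isOpen_Ioo.prod isOpen_Ioo).mem_nhds ⟨hc, ht⟩)
  have hAε : ∀ c ∈ Ioo (c₀ - δ) (c₀ + δ), ContDiffAt ℝ ∞ (fun c => A c ε) c := fun c hc =>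
    (hAat c hc ε hεδ).comp (f := fun c : ℝ => (c, ε)) c (by fun_prop)
  obtain ⟨δ', hδ', hball⟩ := Metric.eventually_nhds_iff_ball.1
    ((hAε c₀ hc₀).continuousAt.eventually htube)
  rw [Real.ball_eq_Ioo] at hball
  have hsub : ∀ c ∈ Ioo (c₀ - min δ δ') (c₀ + min δ δ'), c ∈ Ioo (c₀ - δ) (c₀ + δ) := fun c hc =>
    ⟨by linarith [hc.1, min_le_left δ δ'], by linarith [hc.2, min_le_left δ δ']⟩
  have hsub' : ∀ c ∈ Ioo (c₀ - min δ δ') (c₀ + min δ δ'), c ∈ Ioo (c₀ - δ') (c₀ + δ') :=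
    fun c hc =>
      ⟨by linarith [hc.1, min_le_right δ δ'], by linarith [hc.2, min_le_right δ δ']⟩
  set α : ℝ → ℝ → ℝ × ℝ × ℝ := fun c t => if t ≤ ε then A c t else Φ (A c ε, t - ε) with hα
  have hαγ : ∀ c, ∀ t, ε ≤ t → α c t = Φ (A c ε, t - ε) := fun c t ht => by
    rcases ht.eq_or_lt with rfl | ht
    · simp [hα, (hΦo _).1]
    · simp [hα, not_le.2 ht]
  have hαo : ∀ c ∈ Ioo (c₀ - min δ δ') (c₀ + min δ δ'),
      IsAxisOrbit c T (fun t => (α c t).1) (fun t => (α c t).2.1) (fun t => (α c t).2.2) := by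
    intro c hc
    refine isAxisOrbit_glue hε hεT (hAo c (hsub c hc) ε ⟨hε, hεδ.2⟩)
      (γ := fun t => Φ (A c ε, t - ε)) (fun t ht => ?_) (fun t ht => by simp [hα, ht.2])
      (fun t ht => hαγ c t ht.1)
    have hb := hball c (hsub' c hc) t ht
    refine ⟨?_, (half_pos hm).trans hb.2⟩
    rw [← hfield _ hb.1.le hb.2.le]
    exact hγ _ t ht
  refine ⟨min δ δ', lt_min hδ hδ', α, fun c hc => ⟨hαo c hc, fun S hS hST z' r' θ' h' =>
    huniq c (hsub c hc) S hS _ _ _ _ _ _ ((hαo c hc).mono hST) h'⟩, ?_⟩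
  rintro ⟨c, t⟩ ⟨hc, ht⟩
  rcases lt_or_ge t S' with htS | htS
  · have hAt := hAat c (hsub c hc) t ⟨by linarith [ht.1], htS.trans hSδ⟩
    -- By uniqueness `α` coincides with the smooth local family also beyond `ε`, up to `S'`,
    -- although it is defined there by the flow.
    have heq : ∀ p ∈ Ioo (c₀ - min δ δ') (c₀ + min δ δ') ×ˢ Icc 0 T, p.2 < S' →
        α p.1 p.2 = A p.1 p.2 := fun p hp hpS =>
      huniq p.1 (hsub _ hp.1) S' (hε.trans hεS) _ _ _ _ _ _
        (hAo p.1 (hsub _ hp.1) S' ⟨hε.trans hεS, hSδ⟩) ((hαo p.1 hp.1).mono hST.le)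
        ⟨hp.2.1, hpS.le⟩
    refine hAt.contDiffWithinAt.congr_of_eventuallyEq ?_ (heq _ ⟨hc, ht⟩ htS)
    have hlt : ∀ᶠ p : ℝ × ℝ in 𝓝 (c, t), p.2 < S' :=
      continuousAt_snd.eventually_lt continuousAt_const htS
    filter_upwards [self_mem_nhdsWithin, nhdsWithin_le_nhds hlt] with p hp hpS using heq p hp hpS
  · have htε : ε < t := hεS.trans_le htS
    have hB : ContDiffAt ℝ ∞ (fun p : ℝ × ℝ => Φ (A p.1 ε, p.2 - ε)) (c, t) := by
      refine (hΦat _ _ (hsh t ⟨htε.le, ht.2⟩)).comp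
        (f := fun p : ℝ × ℝ => (A p.1 ε, p.2 - ε)) (c, t) (ContDiffAt.prodMk ?_ (by fun_prop))
      exact (hAε c (hsub c hc)).comp (f := Prod.fst) (c, t) contDiffAt_fst
    refine (hB.congr_of_eventuallyEq ?_).contDiffWithinAt
    have hlt : ∀ᶠ p : ℝ × ℝ in 𝓝 (c, t), ε < p.2 :=
      continuousAt_const.eventually_lt continuousAt_snd htε
    filter_upwards [hlt] with p hp using hαγ p.1 p.2 hp.le

/-- The hemisphere. -/
theorem isAxisOrbit_hemisphere {T : ℝ} (hT : T < √2 * Real.pi) :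
    IsAxisOrbit (√2) T (fun t => √2 * Real.cos (t / √2)) (fun t => √2 * Real.sin (t / √2))
      (fun t => Real.pi / 2 + t / √2) := by
  have h2 : (0 : ℝ) < √2 := by positivity
  have hsq : √2 * √2 = 2 := Real.mul_self_sqrt (by norm_num)
  have hd : ∀ t : ℝ, HasDerivAt (fun t => t / √2) (1 / √2) t := fun t =>
    (hasDerivAt_id t).div_const _
  have hpos : ∀ t ∈ Ioc 0 T, 0 < √2 * Real.sin (t / √2) := fun t ht => by
    refine mul_pos h2 (Real.sin_pos_of_pos_of_lt_pi (div_pos ht.1 h2) ?_)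
    rw [div_lt_iff₀ h2, mul_comm]
    exact ht.2.trans_lt hT
  refine ⟨by simp, by simp, by simp, by fun_prop, hpos, fun t _ => ?_, fun t _ => ?_,
    fun t ht => ?_⟩
  · refine (((hd t).cos.const_mul _).congr_deriv ?_).hasDerivWithinAt
    rw [add_comm, Real.cos_add_pi_div_two]
    field_simp
  · refine (((hd t).sin.const_mul _).congr_deriv ?_).hasDerivWithinAt
    rw [add_comm, Real.sin_add_pi_div_two]
    field_simp
  · refine (((hd t).const_add _).congr_deriv ?_).hasDerivWithinAt
    rw [add_comm (Real.pi / 2), Real.cos_add_pi_div_two, Real.sin_add_pi_div_two]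
    have hs := (pos_of_mul_pos_right (hpos t ht) h2.le).ne'
    have hcs := Real.sin_sq_add_cos_sq (t / √2)
    generalize Real.sin (t / √2) = a at *
    generalize Real.cos (t / √2) = b at *
    field_simp
    rw [Real.sq_sqrt (by norm_num)]
    linarith

end Global

theorem mainTheorem6 (T : ℝ) (hT0 : 0 < T) (hT : T < √2 * Real.pi) :
    ∃ δ : ℝ, 0 < δ ∧ ∃ z r θ : ℝ → ℝ → ℝ,
      (∀ c ∈ Ioo (√2 - δ) (√2 + δ),
        IsAxisOrbit c T (z c) (r c) (θ c) ∧
        ∀ S : ℝ, 0 < S → S ≤ T → ∀ z' r' θ' : ℝ → ℝ, IsAxisOrbit c S z' r' θ' →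
          EqOn z' (z c) (Icc 0 S) ∧ EqOn r' (r c) (Icc 0 S) ∧ EqOn θ' (θ c) (Icc 0 S)) ∧
      ContDiffOn ℝ ∞ (fun p : ℝ × ℝ => (z p.1 p.2, r p.1 p.2, θ p.1 p.2))
        (Ioo (√2 - δ) (√2 + δ) ×ˢ Icc 0 T) := by
  obtain ⟨δ, hδ, α, hα, hsmooth⟩ :=
    exists_contDiffOn_axisOrbit_family hT0 (isAxisOrbit_hemisphere hT)
  refine ⟨δ, hδ, fun c t => (α c t).1, fun c t => (α c t).2.1, fun c t => (α c t).2.2,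
    fun c hc => ⟨(hα c hc).1, fun S hS hST z' r' θ' h' => ?_⟩, hsmooth⟩
  have h := (hα c hc).2 S hS hST z' r' θ' h'
  exact ⟨fun t ht => congrArg (fun x => x.1) (h ht), fun t ht => congrArg (fun x => x.2.1) (h ht),
    fun t ht => congrArg (fun x => x.2.2) (h ht)⟩
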